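/- Let $d\ge 1$ be an integer and $\mathcal A=\{0,1,\dots,2d\}$. Let $\mathbf u=\mathbf u_{2d+1}$ be the unique fixed point $\varphi(\mathbf u)=\mathbf u\in\mathcal A^{\mathbb N}$ of the morphism $\varphi$ on $\mathcal A^*$ given by $\varphi(i)=0(i+1)$ for $0\le i\le 2d-1$ and $\varphi(2d)=0(2d)(2d)$. Put $h_i=1$ for $0\le i<d$ and $h_i=2^{i-d}$ for $d\le i\le 2d$. Let $\pi:\mathcal A^*\to\mathcal B^*$ be a weighted morphism, that is, a morphism such that for every $i\in\mathcal A$: (a) $\pi(i)$ is a palindrome of length $h_i$; (b) the number of distinct letters of $\pi(i)$ is the maximum among palindromes over $\mathcal B$ of length $h_i$; (c) no letter of $\pi(i)$ occurs in $\pi(j)$ for $j\ne i$. Write $\pi(\mathbf u)=\pi(u_0)\pi(u_1)\pi(u_2)\cdots$. A factor of a sequence is left (right) special if it can be extended to the left (right) by at least two distinct letters to a factor of the sequence, and bispecial if it is both. A return word to a factor $v$ of a sequence $x_0x_1x_2\cdots$ is a word $x_jx_{j+1}\cdots x_{\ell-1}$, where $j<\ell$ are two consecutive occurrences of $v$. A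 word $v$ is rich if it has $|v|+1$ distinct palindromic factors (including the empty word), and a sequence is rich if each of its factors is rich. Then: 1. A factor $p$ of $\mathbf u$ is a palindrome if and only if $\pi(p)$ is a palindrome. 2. The sequence $\pi(\mathbf u)$ is rich. 3. Suppose $d\ge 2$. If $w'$ is a bispecial factor of $\pi(\mathbf u)$ of length $>1$, then there is a bispecial factor $w$ of $\mathbf u$ with $w'=\pi(w)$, and for every return word $r'$ to $w'$ in $\pi(\mathbf u)$ there is a return word $r$ to $w$ in $\mathbf u$ with $r'=\pi(r)$. -/

import Mathlib

/-! Words over an alphabet `A` are lists `List A`; sequences are functions `ℕ → A`. -/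

namespace RichWords

/-- The word `u_j u_{j+1} ⋯ u_{j+n-1}`. -/
def window {A : Type*} (u : ℕ → A) (j n : ℕ) : List A :=
  (List.range n).map fun i => u (j + i)

/-- `j` is an occurrence of the word `w` in the sequence `u`. -/
def IsOccurrence {A : Type*} (u : ℕ → A) (w : List A) (j : ℕ) : Prop :=
  window u j w.length = w

/-- `w` is a factor of the sequence `u`. -/
def IsFactor {A : Type*} (u : ℕ → A) (w : List A) : Prop :=
  ∃ j, IsOccurrence u w j

def IsLeftSpecial {A : Type*} (u : ℕ → A) (w : List A) : Prop :=
  IsFactor u w ∧ ∃ a b : A, a ≠ b ∧ IsFactor u (a :: w) ∧ IsFactor u (b :: w)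

def IsRightSpecial {A : Type*} (u : ℕ → A) (w : List A) : Prop :=
  IsFactor u w ∧ ∃ a b : A, a ≠ b ∧ IsFactor u (w ++ [a]) ∧ IsFactor u (w ++ [b])

def IsBispecial {A : Type*} (u : ℕ → A) (w : List A) : Prop :=
  IsLeftSpecial u w ∧ IsRightSpecial u w

/-- `r` is a return word to `w` in `u`: it is `u_j ⋯ u_{l-1}` for two consecutive
occurrences `j < l` of `w`. -/
def IsReturnWord {A : Type*} (u : ℕ → A) (w r : List A) : Prop :=
  ∃ j l : ℕ, j < l ∧ IsOccurrence u w j ∧ IsOccurrence u w l ∧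
    (∀ k, j < k → k < l → ¬ IsOccurrence u w k) ∧ r = window u j (l - j)

/-- A word is rich if it has `|w| + 1` distinct palindromic factors (the empty word included). -/
def IsRichWord {A : Type*} (w : List A) : Prop :=
  {p : List A | p <:+: w ∧ p.Palindrome}.ncard = w.length + 1

/-- A sequence is rich if each of its factors is rich. -/
def IsRichSeq {A : Type*} (u : ℕ → A) : Prop :=
  ∀ w, IsFactor u w → IsRichWord w

/-- A morphism `A* → B*` is given by the images `ψ a` of the letters;
this is the image of a word. -/
def wordImage {A B : Type*} (ψ : A → List B) (w : List A) : List B :=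
  w.flatMap ψ

theorem le_length_wordImage {A B : Type*} {ψ : A → List B} (hψ : ∀ a, ψ a ≠ [])
    (w : List A) : w.length ≤ (wordImage ψ w).length := by
  induction w with
  | nil => simp
  | cons a w ih =>
    have := List.length_pos_iff.2 (hψ a)
    simp only [wordImage, List.flatMap_cons, List.length_append, List.length_cons] at ih ⊢
    omega

/-- The image `ψ(u_0) ψ(u_1) ψ(u_2) ⋯` of a sequence under a non-erasing morphism: its `n`-th
letter is the `n`-th letter of `ψ(u_0 ⋯ u_n)`, a word of length at least `n + 1`. -/
def seqImage {A B : Type*} (ψ : A → List B) (hψ : ∀ a, ψ a ≠ []) (u : ℕ → A) : ℕ → B :=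
  fun n => (wordImage ψ (window u 0 (n + 1)))[n]'(by
    have := le_length_wordImage hψ (window u 0 (n + 1))
    simp only [window, List.length_map, List.length_range] at this ⊢
    omega)

/-- The morphism `0 ↦ 01, 1 ↦ 02, …, n-2 ↦ 0(n-1), n-1 ↦ 0(n-1)(n-1)` on `{0, …, n-1}`. -/
def phi (n : ℕ) [NeZero n] (i : Fin n) : List (Fin n) :=
  if h : i.val + 1 < n then [0, ⟨i.val + 1, h⟩] else [0, i, i]

theorem phi_ne_nil (n : ℕ) [NeZero n] (i : Fin n) : phi n i ≠ [] := by
  unfold phi; split <;> simp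

theorem two_mul_length_le (n : ℕ) [NeZero n] (w : List (Fin n)) :
    2 * w.length ≤ (wordImage (phi n) w).length := by
  induction w with
  | nil => simp
  | cons a w ih =>
    have : 2 ≤ (phi n a).length := by unfold phi; split <;> simp
    simp only [wordImage, List.flatMap_cons, List.length_append, List.length_cons] at ih ⊢
    omega

theorem lt_length_iterate (n : ℕ) [NeZero n] (k : ℕ) :
    k < ((wordImage (phi n))^[k] [0]).length := by
  induction k with
  | zero => simp
  | succ k ih =>
    rw [Function.iterate_succ_apply']
    have := two_mul_length_le n ((wordImage (phi n))^[k] [0])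
    omega

/-- The fixed point of `phi n`, i.e. the limit of the words `phi^k(0)`: its `k`-th letter is the
`k`-th letter of `phi^k(0)`, a word of length at least `k + 1`. -/
def uSeq (n : ℕ) [NeZero n] : ℕ → Fin n :=
  fun k => ((wordImage (phi n))^[k] [0])[k]'(lt_length_iterate n k)

/-- The weights `(1, …, 1, 2^0, 2^1, …, 2^d)`, with `d` ones in front. -/
def weight (d i : ℕ) : ℕ := if i < d then 1 else 2 ^ (i - d)

/-- Weighted morphisms `{0, …, 2d}* → B*`. -/
structure IsWeightedMorphism {B : Type*} (d : ℕ) (π : Fin (2 * d + 1) → List B) : Prop where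
  palindrome : ∀ i, (π i).Palindrome
  length_eq : ∀ i, (π i).length = weight d i
  /-- No palindrome of the same length contains more distinct letters. -/
  maximal : ∀ i : Fin (2 * d + 1), ∀ q : List B, q.Palindrome → q.length = weight d i →
    {b | b ∈ q}.ncard ≤ {b | b ∈ π i}.ncard
  disjoint : ∀ i j, i ≠ j → ∀ b ∈ π i, b ∉ π j

theorem IsWeightedMorphism.ne_nil {B : Type*} {d : ℕ} {π : Fin (2 * d + 1) → List B}
    (h : IsWeightedMorphism d π) (i : Fin (2 * d + 1)) : π i ≠ [] := by
  rw [← List.length_pos_iff, h.length_eq]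
  unfold weight; split <;> positivity

/-! `uSeq n` is a fixed point of `phi n`, and the only one. -/

theorem window_add {A : Type*} (u : ℕ → A) (m k : ℕ) :
    window u 0 (m + k) = window u 0 m ++ window u m k := by
  simp [window, List.range_add, Function.comp_def]

theorem window_prefix {A : Type*} (u : ℕ → A) {m k : ℕ} (h : m ≤ k) :
    window u 0 m <+: window u 0 k := by
  obtain ⟨t, rfl⟩ := Nat.exists_eq_add_of_le h
  exact ⟨_, (window_add u m t).symm⟩

theorem wordImage_prefix {A B : Type*} (ψ : A → List B) {v w : List A} (h : v <+: w) :
    wordImage ψ v <+: wordImage ψ w := by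
  obtain ⟨t, rfl⟩ := h
  exact ⟨wordImage ψ t, by simp [wordImage]⟩

theorem prefix_getElem {A : Type*} {v w : List A} (h : v <+: w) (k : ℕ) (hk : k < v.length) :
    v[k] = w[k]'(hk.trans_le h.length_le) := by
  obtain ⟨t, rfl⟩ := h
  simp [List.getElem_append_left hk]

theorem eq_window {A : Type*} (u : ℕ → A) (w : List A)
    (h : ∀ k (hk : k < w.length), w[k] = u k) : w = window u 0 w.length := by
  apply List.ext_getElem
  · simp [window]
  · intro k h1 h2
    simp [window, h k h1]

/-- `ψ(u_0 ⋯ u_{m-1})` is a prefix of `ψ(u)`. -/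
theorem wordImage_window {A B : Type*} (ψ : A → List B) (hψ : ∀ a, ψ a ≠ []) (u : ℕ → A)
    (m : ℕ) : wordImage ψ (window u 0 m) =
      window (seqImage ψ hψ u) 0 (wordImage ψ (window u 0 m)).length := by
  apply eq_window
  intro k hk
  have hl := le_length_wordImage hψ (window u 0 (k + 1))
  have hl' : (window u 0 (k + 1)).length = k + 1 := by simp [window]
  unfold seqImage
  rcases le_total m (k + 1) with h | h
  · exact prefix_getElem (wordImage_prefix ψ (window_prefix u h)) k hk
  · exact (prefix_getElem (wordImage_prefix ψ (window_prefix u h)) k (by omega)).symm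

theorem iterate_prefix (n : ℕ) [NeZero n] (hn : 2 ≤ n) {k l : ℕ} (h : k ≤ l) :
    (wordImage (phi n))^[k] [0] <+: (wordImage (phi n))^[l] [0] := by
  induction l, h using Nat.le_induction with
  | base => exact List.prefix_rfl
  | succ l hl ih =>
    refine ih.trans ?_
    clear ih hl
    induction l with
    | zero => exact ⟨[⟨1, by omega⟩], by simp [wordImage, phi, show 1 < n by omega]⟩
    | succ l ih =>
      rw [Function.iterate_succ_apply' _ l, Function.iterate_succ_apply' _ (l + 1)]
      exact wordImage_prefix _ ih

theorem seqImage_eq_self_iff (n : ℕ) [NeZero n] (hn : 2 ≤ n) (u : ℕ → Fin n) :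
    seqImage (phi n) (phi_ne_nil n) u = u ↔ u = uSeq n := by
  have key : ∀ k, (wordImage (phi n))^[k] [0] =
      window (uSeq n) 0 ((wordImage (phi n))^[k] [0]).length := by
    intro k
    apply eq_window
    intro m hm
    unfold uSeq
    rcases le_total k m with h | h
    · exact prefix_getElem (iterate_prefix n hn h) m hm
    · exact (prefix_getElem (iterate_prefix n hn h) m (lt_length_iterate n m)).symm
  have hwin : ∀ {v w : ℕ → Fin n} {m : ℕ}, window v 0 m = window w 0 m →
      ∀ k < m, v k = w k := by
    intro v w m h k hk
    have := congrArg (fun l => l[k]?) h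
    simpa [window, hk] using this
  constructor
  · intro hu
    have h0 : u 0 = 0 := by
      rw [← hu]
      have h1 : window u 0 1 = [u 0] := by simp [window]
      unfold seqImage
      simp only [Nat.zero_add, h1, wordImage, List.flatMap_cons, List.flatMap_nil,
        List.append_nil, phi]
      split <;> simp
    have hk : ∀ k, (wordImage (phi n))^[k] [0] =
        window u 0 ((wordImage (phi n))^[k] [0]).length := by
      intro k
      induction k with
      | zero => simp [window, h0]
      | succ k ih =>
        rw [Function.iterate_succ_apply', ih]
        have := wordImage_window (phi n) (phi_ne_nil n) u
          ((wordImage (phi n))^[k] [0]).length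
        rwa [hu] at this
    funext k
    exact hwin ((hk k).symm.trans (key k)) k (lt_length_iterate n k)
  · rintro rfl
    funext k
    have h1 := wordImage_window (phi n) (phi_ne_nil n) (uSeq n)
      ((wordImage (phi n))^[k] [0]).length
    rw [← key k, ← Function.iterate_succ_apply' (wordImage (phi n)) k] at h1
    exact hwin (h1.symm.trans (key (k + 1))) k
      ((Nat.lt_succ_self k).trans (lt_length_iterate n (k + 1)))

end RichWords

open RichWords

/-! Richness follows from palindromic returns: if the span from one occurrence of a palindrome to
the end of the next is always a palindrome, then each new letter of a word creates exactly one new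
palindromic factor, namely the longest palindromic suffix (`isRichWord_of_palReturns`).

Palindromic returns are obtained by desubstitution. Both `uSeq n` and its image under `π` arise from
`uSeq n` by a map `i ↦ a q(i)`, with palindromes `q(i)` free of the marker `a`. A palindrome `y`
containing `a` has the form `s Φ(x) a sᴿ`, with `Φ` this map and `x` a shorter palindrome.
Occurrences of `y` correspond to those of `x` whose two neighbours have blocks ending in `s`. To
make this an induction, one studies occurrences framed by letters of a set `T`. The sets that arise
are subsingletons or final segments (`IsSegment`), because the tails `q(i)` share letters only for
the last two values of `i`.

A palindrome without marker lies inside a tail. Two consecutive occurrences in one tail are handled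
by periodicity, as that tail is `p` or `pp` with `p` a palindrome whose only repetitions are mirror
ones. Between different tails one uses that the gaps of `u` between consecutive letters of a segment
are palindromes (`palGaps_uSeq`). The induction gives `palReturns_uSeq`, and one further application
of the same step gives `palReturns_image_uSeq`. The maximality of weighted morphisms enters only
through `MirrorDistinct`.

Preservation of palindromes holds because `π` is injective on words and commutes with reversal. For
bispecial factors, two consecutive letters of `π(u)` determine the place in a block (`sync_of_two`),
provided that letters squared in `u` have images longer than 2. Only the letter `2d` is squared,
with image of length `2^d`, whence the condition `2 ≤ d`. Special factors then begin or end at block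
boundaries, and everything lifts. -/

namespace RichWords

variable {A B C : Type*}

/-! ### Windows and occurrences -/

@[simp] theorem length_window (u : ℕ → A) (j n : ℕ) : (window u j n).length = n := by
  simp [window]

@[simp] theorem window_zero (u : ℕ → A) (j : ℕ) : window u j 0 = [] := rfl

theorem window_append (u : ℕ → A) (j m k : ℕ) :
    window u j (m + k) = window u j m ++ window u (j + m) k := by
  simp [window, List.range_add, Function.comp_def, Nat.add_assoc]

@[simp] theorem window_one (u : ℕ → A) (j : ℕ) : window u j 1 = [u j] := by
  simp [window]

theorem window_succ (u : ℕ → A) (j n : ℕ) :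
    window u j (n + 1) = u j :: window u (j + 1) n := by
  rw [Nat.add_comm, window_append]; simp

@[simp] theorem getElem_window (u : ℕ → A) (j n k : ℕ) (hk : k < (window u j n).length) :
    (window u j n)[k] = u (j + k) := by
  simp [window]

@[simp] theorem isOccurrence_nil (u : ℕ → A) (j : ℕ) : IsOccurrence u [] j := rfl

theorem isOccurrence_cons {u : ℕ → A} {b : A} {w : List A} {j : ℕ} :
    IsOccurrence u (b :: w) j ↔ u j = b ∧ IsOccurrence u w (j + 1) := by
  simp [IsOccurrence, window_succ]

theorem isOccurrence_singleton {u : ℕ → A} {b : A} {j : ℕ} :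
    IsOccurrence u [b] j ↔ u j = b := by
  simp [isOccurrence_cons]

theorem isOccurrence_append {u : ℕ → A} {w w' : List A} {j : ℕ} :
    IsOccurrence u (w ++ w') j ↔ IsOccurrence u w j ∧ IsOccurrence u w' (j + w.length) := by
  induction w generalizing j with
  | nil => simp
  | cons b w ih =>
    simp only [List.cons_append, isOccurrence_cons, ih, List.length_cons, and_assoc]
    rw [show j + 1 + w.length = j + (w.length + 1) by omega]

theorem isOccurrence_window (u : ℕ → A) (j n : ℕ) : IsOccurrence u (window u j n) j := by
  simp [IsOccurrence]

theorem isOccurrence_iff_getElem {u : ℕ → A} {w : List A} {j : ℕ} :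
    IsOccurrence u w j ↔ ∀ t (ht : t < w.length), u (j + t) = w[t] := by
  constructor
  · intro h t ht
    rw [← getElem_window u j w.length t (by simpa using ht)]
    congr 1
  · intro h
    apply List.ext_getElem
    · simp
    · intro t h1 h2
      simp [h t h2]

theorem IsOccurrence.eq_of_length {u : ℕ → A} {w w' : List A} {j : ℕ}
    (h : IsOccurrence u w j) (h' : IsOccurrence u w' j) (hl : w.length = w'.length) : w = w' := by
  rw [← h, ← h', hl]

theorem IsOccurrence.prefix_of_length_le {u : ℕ → A} {w w' : List A} {j : ℕ}
    (h : IsOccurrence u w j) (h' : IsOccurrence u w' j) (hl : w.length ≤ w'.length) :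
    w <+: w' := by
  obtain ⟨t, ht⟩ := Nat.exists_eq_add_of_le hl
  refine ⟨window u (j + w.length) t, ?_⟩
  unfold IsOccurrence at h h'
  rw [ht, window_append, h] at h'
  exact h'

theorem IsOccurrence.of_prefix {u : ℕ → A} {w w' : List A} {j : ℕ}
    (h : IsOccurrence u w j) (h' : w' <+: w) : IsOccurrence u w' j := by
  obtain ⟨t, rfl⟩ := h'
  exact (isOccurrence_append.1 h).1

/-! ### Images of sequences -/

@[simp] theorem wordImage_nil (ψ : A → List B) : wordImage ψ [] = [] := rfl

@[simp] theorem wordImage_cons (ψ : A → List B) (a : A) (w : List A) :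
    wordImage ψ (a :: w) = ψ a ++ wordImage ψ w := by
  simp [wordImage]

@[simp] theorem wordImage_append (ψ : A → List B) (v w : List A) :
    wordImage ψ (v ++ w) = wordImage ψ v ++ wordImage ψ w := by
  simp [wordImage]

theorem wordImage_wordImage (π : B → List C) (ψ : A → List B) (w : List A) :
    wordImage π (wordImage ψ w) = wordImage (fun a => wordImage π (ψ a)) w := by
  induction w with
  | nil => rfl
  | cons a w ih => simp [ih]

/-- `v` is the sequence `ψ(u_0) ψ(u_1) ψ(u_2) ⋯`, provided this is infinite. -/
def IsImage (ψ : A → List B) (u : ℕ → A) (v : ℕ → B) : Prop :=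
  ∀ m, IsOccurrence v (wordImage ψ (window u 0 m)) 0

theorem isImage_seqImage (ψ : A → List B) (hψ : ∀ a, ψ a ≠ []) (u : ℕ → A) :
    IsImage ψ u (seqImage ψ hψ u) :=
  fun m => (wordImage_window ψ hψ u m).symm

/-- The position in `ψ(u)` where the block `ψ(u_m)` starts. -/
def blockStart (ψ : A → List B) (u : ℕ → A) (m : ℕ) : ℕ :=
  (wordImage ψ (window u 0 m)).length

@[simp] theorem blockStart_zero (ψ : A → List B) (u : ℕ → A) : blockStart ψ u 0 = 0 := rfl

theorem blockStart_add (ψ : A → List B) (u : ℕ → A) (m k : ℕ) :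
    blockStart ψ u (m + k) = blockStart ψ u m + (wordImage ψ (window u m k)).length := by
  simp [blockStart, window_append]

theorem blockStart_succ (ψ : A → List B) (u : ℕ → A) (m : ℕ) :
    blockStart ψ u (m + 1) = blockStart ψ u m + (ψ (u m)).length := by
  simp [blockStart_add]

theorem blockStart_strictMono {ψ : A → List B} (hψ : ∀ a, ψ a ≠ []) (u : ℕ → A) :
    StrictMono (blockStart ψ u) := by
  refine strictMono_nat_of_lt_succ fun m => ?_
  have := List.length_pos_iff.2 (hψ (u m))
  rw [blockStart_succ]; omega

theorem exists_block {ψ : A → List B} (hψ : ∀ a, ψ a ≠ []) (u : ℕ → A) (n : ℕ) :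
    ∃ m o, n = blockStart ψ u m + o ∧ o < (ψ (u m)).length := by
  induction n with
  | zero => exact ⟨0, 0, by simp, List.length_pos_iff.2 (hψ _)⟩
  | succ n ih =>
    obtain ⟨m, o, h, ho⟩ := ih
    by_cases h1 : o + 1 < (ψ (u m)).length
    · exact ⟨m, o + 1, by omega, h1⟩
    · refine ⟨m + 1, 0, ?_, List.length_pos_iff.2 (hψ _)⟩
      rw [blockStart_succ]; omega

theorem block_unique {ψ : A → List B} {u : ℕ → A} {m m' o o' : ℕ} (hψ : ∀ a, ψ a ≠ [])
    (h : blockStart ψ u m + o = blockStart ψ u m' + o') (ho : o < (ψ (u m)).length)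
    (ho' : o' < (ψ (u m')).length) : m = m' ∧ o = o' := by
  have key : m = m' := by
    rcases lt_trichotomy m m' with hl | hl | hl
    · have := (blockStart_strictMono hψ u).monotone (show m + 1 ≤ m' from hl)
      rw [blockStart_succ] at this; omega
    · exact hl
    · have := (blockStart_strictMono hψ u).monotone (show m' + 1 ≤ m from hl)
      rw [blockStart_succ] at this; omega
  subst key
  exact ⟨rfl, by omega⟩

theorem IsImage.occ_window {ψ : A → List B} {u : ℕ → A} {v : ℕ → B} (H : IsImage ψ u v)
    (m k : ℕ) : IsOccurrence v (wordImage ψ (window u m k)) (blockStart ψ u m) := by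
  have := H (m + k)
  rw [window_append, wordImage_append, isOccurrence_append] at this
  simpa [blockStart] using this.2

theorem IsImage.occ_block {ψ : A → List B} {u : ℕ → A} {v : ℕ → B} (H : IsImage ψ u v)
    (m : ℕ) : IsOccurrence v (ψ (u m)) (blockStart ψ u m) := by
  simpa using H.occ_window m 1

theorem IsImage.occ_wordImage {ψ : A → List B} {u : ℕ → A} {v : ℕ → B} (H : IsImage ψ u v)
    {w : List A} {m : ℕ} (h : IsOccurrence u w m) :
    IsOccurrence v (wordImage ψ w) (blockStart ψ u m) := by
  rw [← h]; exact H.occ_window _ _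

theorem IsImage.apply_block {ψ : A → List B} {u : ℕ → A} {v : ℕ → B} (H : IsImage ψ u v)
    {m o : ℕ} (ho : o < (ψ (u m)).length) : v (blockStart ψ u m + o) = (ψ (u m))[o] :=
  isOccurrence_iff_getElem.1 (H.occ_block m) o ho

theorem IsImage.window_eq {ψ : A → List B} {u : ℕ → A} {v : ℕ → B} (H : IsImage ψ u v)
    {m n : ℕ} (h : m ≤ n) :
    window v (blockStart ψ u m) (blockStart ψ u n - blockStart ψ u m) =
      wordImage ψ (window u m (n - m)) := by
  obtain ⟨k, rfl⟩ := Nat.exists_eq_add_of_le h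
  rw [blockStart_add]
  simpa [IsOccurrence] using H.occ_window m k

theorem IsImage.comp {ψ : A → List B} {π : B → List C} {u : ℕ → A} {v : ℕ → B} {w : ℕ → C}
    (H : IsImage ψ u v) (hπ : IsImage π v w) :
    IsImage (fun a => wordImage π (ψ a)) u w := by
  intro m
  rw [← wordImage_wordImage, ← H m]
  exact hπ _

/-! ### Palindromes -/

theorem palindrome_iff {w : List A} : w.Palindrome ↔ w.reverse = w :=
  List.Palindrome.iff_reverse_eq

theorem reverse_wordImage {π : A → List B} (hπ : ∀ a, (π a).Palindrome) (w : List A) :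
    (wordImage π w).reverse = wordImage π w.reverse := by
  induction w with
  | nil => rfl
  | cons a w ih => simp [ih, (hπ a).reverse_eq]

theorem palindrome_conj {s z : List A} (hz : z.Palindrome) :
    (s ++ z ++ s.reverse).Palindrome := by
  rw [palindrome_iff]; simp [hz.reverse_eq]

theorem palindrome_conj_iff {s z : List A} :
    (s ++ z ++ s.reverse).Palindrome ↔ z.Palindrome := by
  simp [palindrome_iff]

theorem palindrome_window_iff {u : ℕ → A} {j n : ℕ} :
    (window u j n).Palindrome ↔ ∀ s t, s + t + 1 = n → u (j + s) = u (j + t) := by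
  rw [palindrome_iff]
  constructor
  · intro h s t hst
    have h1 : (window u j n).reverse[s]'(by simp; omega) = (window u j n)[s]'(by simp; omega) := by
      congr 1
    simp only [List.getElem_reverse, getElem_window, length_window] at h1
    rw [← h1]; congr 2; omega
  · intro h
    apply List.ext_getElem
    · simp
    · intro s h1 h2
      simp only [length_window] at h2
      simp only [List.getElem_reverse, getElem_window, length_window]
      exact h _ _ (by omega)

/-! ### Palindromic returns -/

/-- The word `y` occurs at position `j + 1`, between two letters of `T`. -/
def FramedOcc (u : ℕ → A) (T : Set A) (y : List A) (j : ℕ) : Prop :=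
  ∃ b ∈ T, ∃ c ∈ T, IsOccurrence u (b :: (y ++ [c])) j

/-- Consecutive occurrences of `y` between letters of `T` span a palindrome. -/
def PalReturns (u : ℕ → A) (T : Set A) (y : List A) : Prop :=
  ∀ j l, j < l → FramedOcc u T y j → FramedOcc u T y l →
    (∀ k, j < k → k < l → ¬ FramedOcc u T y k) →
    (window u (j + 1) (l - j + y.length)).Palindrome

/-- The word between two consecutive letters of `T` is a palindrome. -/
def PalGaps (u : ℕ → A) (T : Set A) : Prop :=
  ∀ j l, j < l → u j ∈ T → u l ∈ T → (∀ k, j < k → k < l → u k ∉ T) →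
    (window u (j + 1) (l - j - 1)).Palindrome

theorem framedOcc_iff {u : ℕ → A} {T : Set A} {y : List A} {j : ℕ} :
    FramedOcc u T y j ↔ u j ∈ T ∧ IsOccurrence u y (j + 1) ∧ u (j + 1 + y.length) ∈ T := by
  simp only [FramedOcc, isOccurrence_cons, isOccurrence_append, isOccurrence_nil, and_true]
  constructor
  · rintro ⟨b, hb, c, hc, rfl, h, rfl⟩
    exact ⟨hb, h, hc⟩
  · rintro ⟨h1, h2, h3⟩
    exact ⟨_, h1, _, h3, rfl, h2, rfl⟩

/-! ### Morphisms with a marker -/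

/-- The morphism `i ↦ a q(i)`. -/
abbrev marked (a : B) (q : A → List B) (i : A) : List B := a :: q i

theorem marked_ne_nil (a : B) (q : A → List B) (i : A) : marked a q i ≠ [] :=
  List.cons_ne_nil _ _

/-- `v` is the image of `u` under `i ↦ a q(i)`, where the letter `a` does not occur in the
distinct palindromes `q(i)`. -/
structure IsMarkedImage (a : B) (q : A → List B) (u : ℕ → A) (v : ℕ → B) : Prop where
  image : IsImage (marked a q) u v
  not_mem : ∀ i, a ∉ q i
  pal : ∀ i, (q i).Palindrome
  inj : Function.Injective q

/-- Reversal moves each marker from the front of its block to the back; one extra marker at the end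
restores the form. -/
theorem reverse_marked {a : B} {q : A → List B} (hq : ∀ i, (q i).Palindrome) (z : List A) :
    (wordImage (marked a q) z ++ [a]).reverse = wordImage (marked a q) z.reverse ++ [a] := by
  induction z with
  | nil => rfl
  | cons i z ih =>
    simp only [List.reverse_append, List.reverse_cons, List.reverse_nil, List.nil_append,
      List.singleton_append, wordImage_cons, wordImage_append, wordImage_nil, List.append_nil,
      marked, (hq i).reverse_eq] at ih ⊢
    rw [← List.cons_append, ih]
    simp

theorem palindrome_marked {a : B} {q : A → List B} (hq : ∀ i, (q i).Palindrome) {z : List A}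
    (hz : z.Palindrome) : (wordImage (marked a q) z ++ [a]).Palindrome := by
  rw [palindrome_iff, reverse_marked hq, hz.reverse_eq]

namespace IsMarkedImage

variable {a : B} {q : A → List B} {u : ℕ → A} {v : ℕ → B}

local notation "S" => blockStart (marked a q) u

theorem strictMono : StrictMono (blockStart (marked a q) u) :=
  blockStart_strictMono (marked_ne_nil a q) u

theorem start_succ (m : ℕ) : S (m + 1) = S m + 1 + (q (u m)).length := by
  rw [blockStart_succ]; simp [marked]; omega

theorem start_lt_succ (m : ℕ) : S m < S (m + 1) := strictMono (Nat.lt_succ_self m)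

theorem apply_start (H : IsMarkedImage a q u v) (m : ℕ) : v (S m) = a :=
  (isOccurrence_cons.1 (H.image.occ_block m)).1

theorem occ_tail (H : IsMarkedImage a q u v) (m : ℕ) :
    IsOccurrence v (q (u m) ++ [a]) (S m + 1) := by
  rw [isOccurrence_append, isOccurrence_singleton, ← start_succ]
  exact ⟨(isOccurrence_cons.1 (H.image.occ_block m)).2, H.apply_start _⟩

theorem apply_eq_iff (H : IsMarkedImage a q u v) {n : ℕ} : v n = a ↔ ∃ m, n = S m := by
  constructor
  · intro h
    obtain ⟨m, o, rfl, ho⟩ := exists_block (marked_ne_nil a q) u n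
    rcases o with _ | o
    · exact ⟨m, rfl⟩
    · rw [H.image.apply_block ho] at h
      simp only [marked, List.getElem_cons_succ] at h
      exact absurd (h ▸ List.getElem_mem _) (H.not_mem (u m))
  · rintro ⟨m, rfl⟩
    exact H.apply_start m

/-- A block boundary does not lie inside an occurrence of a word without marker. -/
theorem start_not_mem (H : IsMarkedImage a q u v) {s : List B} (hs : a ∉ s) {j m : ℕ}
    (h : IsOccurrence v s j) (h1 : j ≤ S m) : j + s.length ≤ S m := by
  by_contra h2
  have := isOccurrence_iff_getElem.1 h (S m - j) (by omega)
  rw [show j + (S m - j) = S m by omega, H.apply_start] at this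
  exact hs (this ▸ List.getElem_mem _)

/-- Markers sit exactly at block starts, so they cut an occurrence into blocks, and injectivity of
`q` recovers the letters. The closing marker forces the last block to be complete. -/
theorem occ_image_iff (H : IsMarkedImage a q u v) {x : List A} {n : ℕ} :
    IsOccurrence v (wordImage (marked a q) x ++ [a]) n ↔ ∃ m, n = S m ∧ IsOccurrence u x m := by
  constructor
  · induction x generalizing n with
    | nil => simpa [isOccurrence_cons] using H.apply_eq_iff.1
    | cons i x ih =>
      intro h
      simp only [wordImage_cons, marked, List.cons_append, List.append_assoc] at h
      rw [isOccurrence_cons, isOccurrence_append] at h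
      obtain ⟨h1, h2, h3⟩ := h
      obtain ⟨m, rfl⟩ := H.apply_eq_iff.1 h1
      obtain ⟨m', h4, h5⟩ := ih h3
      have hlt : m < m' := by
        rw [← strictMono.lt_iff_lt (a := m) (b := m') (f := S)]; omega
      have h6 := H.start_not_mem (H.not_mem i) h2 (m := m + 1) (start_lt_succ m)
      have h7 := strictMono.monotone (f := S) (show m + 1 ≤ m' from hlt)
      have h8 : m' = m + 1 := strictMono.injective (f := S) (by omega)
      subst h8
      have h9 := (isOccurrence_append.1 (H.occ_tail m)).1
      have h10 := H.inj (h9.eq_of_length h2 (by rw [start_succ] at h4; omega))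
      exact ⟨m, rfl, isOccurrence_cons.2 ⟨h10, h5⟩⟩
  · rintro ⟨m, rfl, h⟩
    rw [isOccurrence_append]
    refine ⟨H.image.occ_wordImage h, ?_⟩
    have := blockStart_add (marked a q) u m x.length
    rw [h] at this
    rw [← this, isOccurrence_singleton]
    exact H.apply_start _

theorem suffix_of_occ (H : IsMarkedImage a q u v) {b : B} {s : List B} (hs : a ∉ s) {j m' : ℕ}
    (h : IsOccurrence v (b :: s) j) (hj : j + 1 + s.length = S m') :
    ∃ m, m' = m + 1 ∧ b :: s <:+ marked a q (u m) := by
  rcases m' with _ | m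
  · simp at hj
  refine ⟨m, rfl, ?_⟩
  have h1 : S m ≤ j := by
    by_contra h2
    have := H.start_not_mem hs (isOccurrence_cons.1 h).2 (m := m) (by omega)
    have := start_lt_succ (a := a) (q := q) (u := u) m
    omega
  refine ⟨window v (S m) (j - S m), ?_⟩
  rw [start_succ] at hj
  have h2 := H.image.occ_block m
  refine IsOccurrence.eq_of_length (u := v) (j := S m) ?_ h2 (by simp [marked]; omega)
  rw [isOccurrence_append]
  refine ⟨isOccurrence_window _ _ _, ?_⟩
  simpa [show S m + (j - S m) = j by omega] using h

theorem occ_of_suffix (H : IsMarkedImage a q u v) {s : List B} {m : ℕ}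
    (h : s <:+ marked a q (u m)) : ∃ j, j + s.length = S (m + 1) ∧ IsOccurrence v s j := by
  obtain ⟨p, hp⟩ := h
  have h1 := H.image.occ_block m
  rw [← hp, isOccurrence_append] at h1
  refine ⟨_, ?_, h1.2⟩
  rw [blockStart_succ, ← hp]; simp; omega

/-- As `q (u m)` is a palindrome, prefixes of `q (u m) ++ [a]` are the reversals of suffixes of `a
:: q (u m)`. Hence one set `framing` serves on both sides. -/
theorem occ_right_iff (H : IsMarkedImage a q u v) {c : B} {s : List B} (hs : a ∉ s) {m : ℕ} :
    IsOccurrence v (s.reverse ++ [c]) (S m + 1) ↔ c :: s <:+ marked a q (u m) := by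
  have e : s.reverse ++ [c] <+: q (u m) ++ [a] ↔ c :: s <:+ marked a q (u m) := by
    rw [← List.reverse_suffix]
    simp [(H.pal (u m)).reverse_eq]
  rw [← e]
  constructor
  · intro h
    have h1 := H.start_not_mem (s := s.reverse) (by simpa) (isOccurrence_append.1 h).1
      (m := m + 1) (start_lt_succ m)
    refine h.prefix_of_length_le (H.occ_tail m) ?_
    rw [start_succ] at h1
    simp at h1 ⊢; omega
  · exact (H.occ_tail m).of_prefix

/-- The letters `i` such that `s`, preceded by a letter of `T`, is a suffix of `a q(i)`. -/
def framing (a : B) (q : A → List B) (T : Set B) (s : List B) : Set A :=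
  {i | ∃ b ∈ T, b :: s <:+ marked a q i}

/-- The markers determine the blocks of `x`; the outer pieces `s` and `s.reverse`, with their
frames, only restrict the letters of `u` adjacent to `x`. -/
theorem framedOcc_image_iff (H : IsMarkedImage a q u v) {T : Set B} {s : List B} (hs : a ∉ s)
    {x : List A} {j : ℕ} :
    FramedOcc v T (s ++ (wordImage (marked a q) x ++ [a]) ++ s.reverse) j ↔
      ∃ m, j + 1 + s.length = S (m + 1) ∧ FramedOcc u (framing a q T s) x m := by
  have hpos : ∀ m, IsOccurrence u x m →
      S m + (wordImage (marked a q) x).length = S (m + x.length) := by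
    intro m hx
    have := blockStart_add (marked a q) u m x.length
    rw [hx] at this
    exact this.symm
  have e : ∀ b c, b :: (s ++ (wordImage (marked a q) x ++ [a]) ++ s.reverse ++ [c]) =
      (b :: s) ++ ((wordImage (marked a q) x ++ [a]) ++ (s.reverse ++ [c])) := by simp
  constructor
  · rintro ⟨b, hb, c, hc, h⟩
    rw [e, isOccurrence_append, isOccurrence_append] at h
    obtain ⟨h1, h2, h3⟩ := h
    obtain ⟨m', h4, h5⟩ := H.occ_image_iff.1 h2
    have h4' : j + 1 + s.length = S m' := by rw [← h4]; simp; omega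
    obtain ⟨m, rfl, h6⟩ := H.suffix_of_occ hs h1 h4'
    refine ⟨m, h4', framedOcc_iff.2 ⟨⟨b, hb, h6⟩, h5, c, hc, ?_⟩⟩
    rw [← H.occ_right_iff hs, ← hpos _ h5, ← h4]
    simpa [Nat.add_assoc] using h3
  · rintro ⟨m, hj, h⟩
    obtain ⟨⟨b, hb, h1⟩, h2, c, hc, h3⟩ := framedOcc_iff.1 h
    refine ⟨b, hb, c, hc, ?_⟩
    rw [e, isOccurrence_append, isOccurrence_append]
    have hj' : j + (b :: s).length = S (m + 1) := by rw [← hj]; simp; omega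
    obtain ⟨j', hj1, hj2⟩ := H.occ_of_suffix h1
    obtain rfl : j' = j := by omega
    refine ⟨hj2, ?_, ?_⟩
    · rw [hj']
      exact H.occ_image_iff.2 ⟨_, rfl, h2⟩
    · rw [hj']
      rw [← H.occ_right_iff hs, ← hpos _ h2] at h3
      simpa [Nat.add_assoc] using h3

/-- The correspondence of framed occurrences preserves order, so consecutive ones come from
consecutive ones. The span is the marked image of a palindrome, enclosed by `s` and `s.reverse`. -/
theorem palReturns_image (H : IsMarkedImage a q u v) {T : Set B} {s : List B} (hs : a ∉ s)
    {x : List A} (h : PalReturns u (framing a q T s) x) :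
    PalReturns v T (s ++ (wordImage (marked a q) x ++ [a]) ++ s.reverse) := by
  intro j l hjl hj hl hb
  obtain ⟨m, hm, hj'⟩ := (H.framedOcc_image_iff hs).1 hj
  obtain ⟨n, hn, hl'⟩ := (H.framedOcc_image_iff hs).1 hl
  have hmn : m < n := by
    have : S (m + 1) < S (n + 1) := by omega
    have := strictMono.lt_iff_lt.1 this
    omega
  have hp := h m n hmn hj' hl' (by
    intro k h1 h2 h3
    have h4 : S (m + 1) < S (k + 1) := strictMono (by omega)
    have h5 : S (k + 1) < S (n + 1) := strictMono (by omega)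
    refine hb (S (k + 1) - 1 - s.length) (by omega) (by omega) ?_
    exact (H.framedOcc_image_iff hs).2 ⟨k, by omega, h3⟩)
  obtain ⟨b, hb1, c, hc1, hj1⟩ := hj
  obtain ⟨b', hb1', c', hc1', hl1⟩ := hl
  have ox := (framedOcc_iff.1 hl').2.1
  have hS := blockStart_add (marked a q) u (m + 1) (n - m + x.length)
  have hS' := blockStart_add (marked a q) u (n + 1) x.length
  rw [ox] at hS'
  rw [show m + 1 + (n - m + x.length) = n + 1 + x.length by omega, hS'] at hS
  have key : IsOccurrence v (s ++ (wordImage (marked a q)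
      (window u (m + 1) (n - m + x.length)) ++ [a]) ++ s.reverse) (j + 1) := by
    rw [isOccurrence_append, isOccurrence_append]
    simp only [isOccurrence_cons, isOccurrence_append] at hj1 hl1
    refine ⟨⟨hj1.2.1.1.1, ?_⟩, ?_⟩
    · rw [hm]
      exact H.occ_image_iff.2 ⟨_, rfl, isOccurrence_window _ _ _⟩
    · have := hl1.2.1.2
      simp only [List.length_append, List.length_singleton] at this ⊢
      convert this using 1
      omega
  have hlen : (s ++ (wordImage (marked a q)
      (window u (m + 1) (n - m + x.length)) ++ [a]) ++ s.reverse).length =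
      l - j + (s ++ (wordImage (marked a q) x ++ [a]) ++ s.reverse).length := by
    simp only [List.length_append, List.length_singleton, List.length_reverse]
    omega
  rw [IsOccurrence, hlen] at key
  rw [key]
  exact palindrome_conj (palindrome_marked H.pal hp)

theorem wordImage_injective (H : IsMarkedImage a q u v) {x x' : List A}
    (h : wordImage (marked a q) x ++ [a] = wordImage (marked a q) x' ++ [a]) : x = x' := by
  have ha := H.not_mem
  have hinj := H.inj
  clear H
  have key : ∀ {l l' r r' : List B}, a ∉ l → a ∉ l' → l ++ a :: r = l' ++ a :: r' →
      l = l' ∧ r = r' := by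
    intro l
    induction l with
    | nil =>
      intro l' r r' _ h2 h3
      cases l' with
      | nil => simpa using h3
      | cons b l' => simp at h3; simp [h3.1] at h2
    | cons b l ih =>
      intro l' r r' h1 h2 h3
      cases l' with
      | nil => simp at h3; simp [h3.1] at h1
      | cons b' l' =>
        simp at h1 h2 h3
        obtain ⟨h4, h5⟩ := ih h1.2 h2.2 h3.2
        exact ⟨by rw [h3.1, h4], h5⟩
  have hshape : ∀ z : List A, ∃ r, wordImage (marked a q) z ++ [a] = a :: r := by
    intro z
    cases z with
    | nil => exact ⟨[], rfl⟩
    | cons i z => exact ⟨_, by simp [marked]; rfl⟩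
  induction x generalizing x' with
  | nil =>
    cases x' with
    | nil => rfl
    | cons i x' => simp [marked] at h
  | cons i x ih =>
    cases x' with
    | nil => simp [marked] at h
    | cons i' x' =>
      obtain ⟨r, hr⟩ := hshape x
      obtain ⟨r', hr'⟩ := hshape x'
      simp only [wordImage_cons, marked, List.cons_append, List.append_assoc, List.cons.injEq,
        true_and] at h
      unfold marked at hr hr'
      rw [hr, hr'] at h
      obtain ⟨h1, h2⟩ := key (ha i) (ha i') h
      rw [hinj h1, ih (x' := x')]
      unfold marked
      rw [hr, hr', h2]

/-- A palindromic factor of `v` containing the marker comes from a palindrome. -/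
theorem exists_decomposition (H : IsMarkedImage a q u v) {y : List B} (hy : y.Palindrome)
    (ha : a ∈ y) {j : ℕ} (hj : IsOccurrence v y j) :
    ∃ s x, a ∉ s ∧ x.Palindrome ∧ y = s ++ (wordImage (marked a q) x ++ [a]) ++ s.reverse := by
  obtain ⟨s, t, rfl, hs⟩ := List.eq_append_cons_of_mem ha
  have hrev := hy.reverse_eq
  simp only [List.reverse_append, List.reverse_cons, List.append_assoc,
    List.singleton_append] at hrev
  have hsuf : s.reverse <:+ s ++ a :: t := by
    rw [← hrev]; exact ⟨t.reverse ++ [a], by simp⟩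
  -- `s` ends just before the first marker, so `a :: t` cannot be a suffix of `s.reverse`.
  have hst : s.reverse <:+ t := by
    have h1 : t <:+ s ++ a :: t := ⟨s ++ [a], by simp⟩
    have h2 : a :: t <:+ s ++ a :: t := ⟨s, rfl⟩
    rcases Nat.lt_or_ge t.length s.length with h | h
    · have := List.suffix_of_suffix_length_le h2 hsuf (by simpa using h)
      exact absurd (by simpa using this.subset List.mem_cons_self) hs
    · exact List.suffix_of_suffix_length_le hsuf h1 (by simpa using h)
  obtain ⟨t', rfl⟩ := hst
  have hz : (a :: t').Palindrome := by
    have : s ++ a :: (t' ++ s.reverse) = s ++ (a :: t') ++ s.reverse := by simp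
    rwa [this, palindrome_conj_iff] at hy
  have ho : IsOccurrence v (a :: t') (j + s.length) := by
    have : s ++ a :: (t' ++ s.reverse) = s ++ (a :: t') ++ s.reverse := by simp
    rw [this, isOccurrence_append, isOccurrence_append] at hj
    exact hj.1.2
  obtain ⟨m, hm⟩ := H.apply_eq_iff.1 (isOccurrence_cons.1 ho).1
  have hlast : v (j + s.length + t'.length) = a := by
    have h1 := isOccurrence_iff_getElem.1 ho t'.length (by simp)
    rw [h1]
    have h2 : (a :: t').reverse[0]'(by simp) = (a :: t')[0] := by
      congr 1; exact hz.reverse_eq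
    rw [List.getElem_reverse] at h2
    simpa using h2
  obtain ⟨n, hn⟩ := H.apply_eq_iff.1 hlast
  have hmn : m ≤ n := strictMono.le_iff_le.1 (show S m ≤ S n by omega)
  have hx : a :: t' = wordImage (marked a q) (window u m (n - m)) ++ [a] := by
    rw [hm] at ho
    refine ho.eq_of_length (H.occ_image_iff.2 ⟨m, rfl, isOccurrence_window _ _ _⟩) ?_
    have := blockStart_add (marked a q) u m (n - m)
    rw [Nat.add_sub_cancel' hmn] at this
    simp only [List.length_append, List.length_cons, List.length_nil]
    omega
  refine ⟨s, window u m (n - m), hs, ?_, ?_⟩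
  · have := hz.reverse_eq
    rw [hx, reverse_marked H.pal] at this
    exact palindrome_iff.2 (H.wordImage_injective this)
  · rw [← hx]; simp

/-- The word `y` occurs between two letters of `T` in `a q(i) a`, the first of them being
at position `o`. -/
def BlockOcc (a : B) (q : A → List B) (T : Set B) (y : List B) (i : A) (o : ℕ) : Prop :=
  ∃ b ∈ T, ∃ c ∈ T, ∃ p r, p.length = o ∧ a :: (q i ++ [a]) = p ++ (b :: (y ++ [c])) ++ r

theorem BlockOcc.add_le {T : Set B} {y : List B} {i : A} {o : ℕ} (h : BlockOcc a q T y i o) :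
    o + y.length ≤ (q i).length := by
  obtain ⟨b, -, c, -, p, r, rfl, h⟩ := h
  have := congrArg List.length h
  simp at this; omega

theorem BlockOcc.reflect {T : Set B} {y : List B} {i : A} {o : ℕ} (hy : y.Palindrome)
    (hq : (q i).Palindrome) (h : BlockOcc a q T y i o) :
    BlockOcc a q T y i ((q i).length - y.length - o) := by
  obtain ⟨b, hb, c, hc, p, r, rfl, h⟩ := h
  refine ⟨c, hc, b, hb, r.reverse, p.reverse, ?_, ?_⟩
  · have := congrArg List.length h
    simp at this ⊢; omega
  · have := congrArg List.reverse h
    simpa [hy.reverse_eq, hq.reverse_eq] using this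

theorem framedOcc_iff_blockOcc (H : IsMarkedImage a q u v) {T : Set B} {y : List B}
    (hy : a ∉ y) {j : ℕ} :
    FramedOcc v T y j ↔ ∃ m o, j = S m + o ∧ BlockOcc a q T y (u m) o := by
  have hocc : ∀ m, IsOccurrence v (a :: (q (u m) ++ [a])) (S m) := fun m =>
    isOccurrence_cons.2 ⟨H.apply_start m, H.occ_tail m⟩
  constructor
  · rintro ⟨b, hb, c, hc, h⟩
    obtain ⟨m, o, rfl, ho⟩ := exists_block (marked_ne_nil a q) u j
    refine ⟨m, o, rfl, b, hb, c, hc, window v (S m) o,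
      window v (S m + o + y.length + 2) ((q (u m)).length - o - y.length), by simp, ?_⟩
    have h1 := H.start_not_mem hy
      (isOccurrence_append.1 (isOccurrence_cons.1 h).2).1 (m := m + 1)
      (by rw [start_succ]; simp [marked] at ho; omega)
    rw [start_succ] at h1
    refine (hocc m).eq_of_length ?_ (by simp; omega)
    rw [isOccurrence_append, isOccurrence_append]
    refine ⟨⟨isOccurrence_window _ _ _, by simpa using h⟩, ?_⟩
    convert isOccurrence_window v _ _ using 1
    simp; omega
  · rintro ⟨m, o, rfl, b, hb, c, hc, p, r, rfl, h⟩
    have h1 := hocc m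
    rw [h, isOccurrence_append, isOccurrence_append] at h1
    exact ⟨b, hb, c, hc, h1.1.2⟩

/-- A word without marker stays inside one block. If two consecutive occurrences lie in different
blocks, the span is the end of one tail, the marked image of a gap of `u`, and the start of another
tail: `hgap` makes the middle a palindrome and `hdiff` makes the ends mirror images. -/
theorem palReturns_of_blockOcc (H : IsMarkedImage a q u v) {T : Set B} {y : List B}
    (hy : a ∉ y) (hgap : PalGaps u {i | ∃ o, BlockOcc a q T y i o})
    (hsame : ∀ i o o', o < o' → BlockOcc a q T y i o → BlockOcc a q T y i o' →
      (∀ k, o < k → k < o' → ¬ BlockOcc a q T y i k) →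
      (((q i).drop o).take (o' - o + y.length)).Palindrome)
    (hdiff : ∀ i i' o o', BlockOcc a q T y i o → (∀ k, o < k → ¬ BlockOcc a q T y i k) →
      BlockOcc a q T y i' o' → (∀ k, k < o' → ¬ BlockOcc a q T y i' k) →
      (q i).drop o = ((q i').take (o' + y.length)).reverse) :
    PalReturns v T y := by
  have hq : ∀ m, IsOccurrence v (q (u m)) (S m + 1) := fun m =>
    (isOccurrence_append.1 (H.occ_tail m)).1
  intro j l hjl hj hl hb
  obtain ⟨m, o, rfl, hm⟩ := (H.framedOcc_iff_blockOcc hy).1 hj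
  obtain ⟨n, o', rfl, hn⟩ := (H.framedOcc_iff_blockOcc hy).1 hl
  have hmle := hm.add_le
  have hnle := hn.add_le
  have hmn : m ≤ n := by
    by_contra hlt
    have := strictMono.monotone (f := S) (show n + 1 ≤ m by omega)
    rw [start_succ] at this
    omega
  rcases hmn.eq_or_lt with rfl | hlt
  · have hp := hsame (u m) o o' (by omega) hm hn (by
      intro k h1 h2 h3
      exact hb (S m + k) (by omega) (by omega) ((H.framedOcc_iff_blockOcc hy).2 ⟨m, k, rfl, h3⟩))
    convert hp using 1
    have h1 := hq m
    rw [← List.take_append_drop o (q (u m)), isOccurrence_append] at h1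
    have h2 := h1.2.of_prefix (List.take_prefix (o' - o + y.length) _)
    have hl : (List.take (o' - o + y.length) (List.drop o (q (u m)))).length =
        S m + o' - (S m + o) + y.length := by
      simp; omega
    rw [IsOccurrence, hl] at h2
    rw [← h2]
    congr 1
    simp; omega
  · have hp := hgap m n hlt ⟨o, hm⟩ ⟨o', hn⟩ (by
      rintro k h1 h2 ⟨o₁, h3⟩
      have := h3.add_le
      have h4 := strictMono.monotone (f := S) (show m + 1 ≤ k by omega)
      have h5 := strictMono.monotone (f := S) (show k + 1 ≤ n by omega)
      rw [start_succ] at h4 h5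
      exact hb (S k + o₁) (by omega) (by omega)
        ((H.framedOcc_iff_blockOcc hy).2 ⟨k, o₁, rfl, h3⟩))
    have h4 := strictMono.monotone (f := S) (show m + 1 ≤ n by omega)
    rw [start_succ] at h4
    have hd := hdiff (u m) (u n) o o' hm (by
        intro k h1 h2
        have := h2.add_le
        exact hb (S m + k) (by omega) (by omega)
          ((H.framedOcc_iff_blockOcc hy).2 ⟨m, k, rfl, h2⟩)) hn (by
        intro k h1 h2
        have := h2.add_le
        exact hb (S n + k) (by omega) (by omega)
          ((H.framedOcc_iff_blockOcc hy).2 ⟨n, k, rfl, h2⟩))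
    have hS := blockStart_add (marked a q) u (m + 1) (n - m - 1)
    rw [show m + 1 + (n - m - 1) = n by omega, start_succ] at hS
    have key : IsOccurrence v ((q (u m)).drop o ++ (wordImage (marked a q)
        (window u (m + 1) (n - m - 1)) ++ [a]) ++ (q (u n)).take (o' + y.length))
        (S m + o + 1) := by
      rw [isOccurrence_append, isOccurrence_append]
      have h1 := hq m
      rw [← List.take_append_drop o (q (u m)), isOccurrence_append] at h1
      refine ⟨⟨?_, ?_⟩, ?_⟩
      · convert h1.2 using 1
        simp; omega
      · refine H.occ_image_iff.2 ⟨m + 1, ?_, isOccurrence_window _ _ _⟩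
        rw [start_succ]; simp; omega
      · convert (hq n).of_prefix (List.take_prefix _ _) using 1
        simp only [List.length_append, List.length_drop, List.length_singleton]
        omega
    have hlen : ((q (u m)).drop o ++ (wordImage (marked a q)
        (window u (m + 1) (n - m - 1)) ++ [a]) ++ (q (u n)).take (o' + y.length)).length =
        S n + o' - (S m + o) + y.length := by
      simp only [List.length_append, List.length_singleton, List.length_drop, List.length_take]
      omega
    rw [IsOccurrence, hlen] at key
    rw [key, ← List.reverse_reverse ((q (u n)).take (o' + y.length)), ← hd]
    exact palindrome_conj (palindrome_marked H.pal hp)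

/-- By symmetry, only the first occurrences in the blocks have to be compared. -/
theorem drop_eq_of_first {T : Set B} {y : List B} (hy : y.Palindrome)
    (hq : ∀ i, (q i).Palindrome)
    (hfirst : ∀ i i' o o', i ≠ i' → BlockOcc a q T y i o → (∀ k, k < o → ¬ BlockOcc a q T y i k) →
      BlockOcc a q T y i' o' → (∀ k, k < o' → ¬ BlockOcc a q T y i' k) →
      (q i).take (o + y.length) = (q i').take (o' + y.length))
    (i i' : A) (o o' : ℕ) (h1 : BlockOcc a q T y i o) (h2 : ∀ k, o < k → ¬ BlockOcc a q T y i k)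
    (h3 : BlockOcc a q T y i' o') (h4 : ∀ k, k < o' → ¬ BlockOcc a q T y i' k) :
    (q i).drop o = ((q i').take (o' + y.length)).reverse := by
  have hle := h1.add_le
  -- Reflecting the block turns the last occurrence in it into the first.
  have h5 := h1.reflect hy (hq i)
  have h6 : ∀ k, k < (q i).length - y.length - o → ¬ BlockOcc a q T y i k := by
    intro k hk h
    exact h2 _ (by omega) (h.reflect hy (hq i))
  have h7 : (q i).drop o = ((q i).take ((q i).length - y.length - o + y.length)).reverse := by
    rw [List.reverse_take, (hq i).reverse_eq]
    congr 1; omega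
  rw [h7]
  congr 1
  by_cases hi : i = i'
  · subst hi
    congr 2
    rcases lt_trichotomy ((q i).length - y.length - o) o' with h | h | h
    · exact absurd h5 (h4 _ h)
    · exact h
    · exact absurd h3 (h6 _ h)
  · exact hfirst i i' _ _ hi h5 h6 h3 h4

/-- Gaps between letters of a set `T` not containing the marker and containing either all letters
of `q(i)` or none, according to whether `i` is in `T₀`. -/
theorem palGaps_image (H : IsMarkedImage a q u v) {T : Set B} (haT : a ∉ T) {T₀ : Set A}
    (hT : ∀ i (t : ℕ) (ht : t < (q i).length), (q i)[t] ∈ T → i ∈ T₀)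
    (hT₀ : ∀ i ∈ T₀, ∀ (t : ℕ) (ht : t < (q i).length), (q i)[t] ∈ T)
    (hne : ∀ i, q i ≠ []) (h : PalGaps u T₀) : PalGaps v T := by
  intro j l hjl hj hl hb
  have cls : ∀ n, v n ∈ T → ∃ m t, n = S m + 1 + t ∧ t < (q (u m)).length ∧ u m ∈ T₀ := by
    intro n hn
    obtain ⟨m, o, rfl, ho⟩ := exists_block (marked_ne_nil a q) u n
    rcases o with _ | o
    · exact absurd (H.apply_start m ▸ hn) haT
    · have ho' : o < (q (u m)).length := by simpa [marked] using ho
      rw [H.image.apply_block ho] at hn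
      exact ⟨m, o, by omega, ho', hT _ o ho' (by simpa [marked] using hn)⟩
  have cls' : ∀ m t, u m ∈ T₀ → t < (q (u m)).length → v (S m + 1 + t) ∈ T := by
    intro m t h1 h2
    have := isOccurrence_iff_getElem.1 (isOccurrence_append.1 (H.occ_tail m)).1 t h2
    rw [this]
    exact hT₀ _ h1 t h2
  obtain ⟨m, t, rfl, ht, hm⟩ := cls j hj
  obtain ⟨n, t', rfl, ht', hn⟩ := cls l hl
  have hmn : m ≤ n := by
    by_contra hlt
    have := strictMono.monotone (f := S) (show n + 1 ≤ m by omega)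
    rw [start_succ] at this
    omega
  rcases hmn.eq_or_lt with rfl | hlt
  · have : t' = t + 1 := by
      by_contra hne
      exact hb (S m + 1 + (t + 1)) (by omega) (by omega) (cls' m (t + 1) hm (by omega))
    subst this
    rw [show S m + 1 + (t + 1) - (S m + 1 + t) - 1 = 0 by omega]
    exact .nil
  · have h4 := strictMono.monotone (f := S) (show m + 1 ≤ n by omega)
    rw [start_succ] at h4
    -- A tail meeting `T` lies entirely in `T`, so the first position must end its tail and the
    -- second must begin its own.
    have e1 : t + 1 = (q (u m)).length := by
      by_contra hne
      exact hb (S m + 1 + (t + 1)) (by omega) (by omega) (cls' m (t + 1) hm (by omega))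
    have e2 : t' = 0 := by
      by_contra hne
      exact hb (S n + 1 + 0) (by omega) (by omega) (cls' n 0 hn (by omega))
    subst e2
    have hp := h m n hlt hm hn (by
      intro k h1 h2 h3
      have h5 := strictMono.monotone (f := S) (show m + 1 ≤ k by omega)
      have h6 := strictMono.monotone (f := S) (show k + 1 ≤ n by omega)
      rw [start_succ] at h5 h6
      exact hb (S k + 1 + 0) (by omega) (by omega)
        (cls' k 0 h3 (List.length_pos_iff.2 (hne _))))
    have hS := blockStart_add (marked a q) u (m + 1) (n - m - 1)
    rw [show m + 1 + (n - m - 1) = n by omega, start_succ] at hS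
    have key : IsOccurrence v (wordImage (marked a q) (window u (m + 1) (n - m - 1)) ++ [a])
        (S m + 1 + t + 1) :=
      H.occ_image_iff.2 ⟨m + 1, by rw [start_succ]; omega, isOccurrence_window _ _ _⟩
    have hlen : (wordImage (marked a q) (window u (m + 1) (n - m - 1)) ++ [a]).length =
        S n + 1 + 0 - (S m + 1 + t) - 1 := by
      simp only [List.length_append, List.length_singleton]
      omega
    rw [IsOccurrence, hlen] at key
    rw [key]
    exact palindrome_marked H.pal hp

/-- The gaps between two consecutive markers. -/
theorem palGaps_marker (H : IsMarkedImage a q u v) : PalGaps v {a} := by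
  intro j l hjl hj hl hb
  obtain ⟨m, rfl⟩ := H.apply_eq_iff.1 hj
  obtain ⟨n, rfl⟩ := H.apply_eq_iff.1 hl
  have hlt : m < n := strictMono.lt_iff_lt.1 hjl
  have : n = m + 1 := by
    by_contra hne
    exact hb (S (m + 1)) (start_lt_succ m) (strictMono (by omega)) (H.apply_start _)
  subst this
  have := (isOccurrence_append.1 (H.occ_tail m)).1
  rw [start_succ, show S m + 1 + (q (u m)).length - S m - 1 = (q (u m)).length by omega, this]
  exact H.pal _

end IsMarkedImage

/-! ### Periodic repetitions of a palindrome with distinct letters in its first half -/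

/-- Equal letters of `p` are in equal or symmetric positions. -/
def MirrorDistinct (p : List B) : Prop :=
  ∀ s t (hs : s < p.length) (ht : t < p.length), p[s] = p[t] → s = t ∨ s + t + 1 = p.length

/-- The periodic sequence `p p p ⋯`. -/
def periodic (p : List B) (hp : p ≠ []) (t : ℕ) : B :=
  p[t % p.length]'(Nat.mod_lt _ (List.length_pos_iff.2 hp))

section periodic

variable {p : List B} (hp : p ≠ [])

/-- Repeating a palindrome gives a sequence invariant under the reflection `s ↦ -1 - s` modulo the
period. -/
theorem periodic_eq_of_dvd (hpal : p.Palindrome) {s t : ℕ} (h : p.length ∣ s + t + 1) :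
    periodic p hp s = periodic p hp t := by
  have hpos := List.length_pos_iff.2 hp
  have hs := Nat.mod_lt s hpos
  have ht := Nat.mod_lt t hpos
  have h1 : p.length ∣ s % p.length + t % p.length + 1 := by
    have : s % p.length + t % p.length + 1 ≡ s + t + 1 [MOD p.length] :=
      ((Nat.mod_modEq _ _).add (Nat.mod_modEq _ _)).add_right 1
    exact (Nat.ModEq.dvd_iff this (dvd_refl _)).2 h
  have h2 : s % p.length + t % p.length + 1 = p.length := by
    obtain ⟨k, hk⟩ := h1
    have : k = 1 := by
      have h3 : k < 2 := by
        by_contra h4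
        have := Nat.mul_le_mul_left p.length (show 2 ≤ k by omega)
        omega
      have h5 : k ≠ 0 := by rintro rfl; omega
      omega
    subst this; omega
  unfold periodic
  have h3 : p.reverse[s % p.length]'(by simpa) = p[s % p.length] := by
    congr 1; exact hpal.reverse_eq
  rw [← h3, List.getElem_reverse]
  congr 1; omega

theorem periodic_eq_of_modEq {s t : ℕ} (h : s ≡ t [MOD p.length]) :
    periodic p hp s = periodic p hp t := by
  unfold periodic
  congr 1

/-- Translations by periods and these reflections account for all coincidences of letters. -/
theorem modEq_or_dvd_of_periodic_eq (hm : MirrorDistinct p) {s t : ℕ}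
    (h : periodic p hp s = periodic p hp t) :
    s ≡ t [MOD p.length] ∨ p.length ∣ s + t + 1 := by
  rcases hm _ _ _ _ h with h | h
  · exact Or.inl h
  · right
    have : s % p.length + t % p.length + 1 ≡ s + t + 1 [MOD p.length] :=
      ((Nat.mod_modEq _ _).add (Nat.mod_modEq _ _)).add_right 1
    exact (Nat.ModEq.dvd_iff this (dvd_refl _)).1 (by rw [h])

theorem isOccurrence_periodic : IsOccurrence (periodic p hp) p 0 := by
  rw [isOccurrence_iff_getElem]
  intro t ht
  simp [periodic, Nat.mod_eq_of_lt ht]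

theorem isOccurrence_periodic_append : IsOccurrence (periodic p hp) (p ++ p) 0 := by
  rw [isOccurrence_append]
  refine ⟨isOccurrence_periodic hp, ?_⟩
  rw [isOccurrence_iff_getElem]
  intro t ht
  simp [periodic, Nat.mod_eq_of_lt ht]

/-- The span is a palindrome as soon as the period divides `o + o' + y.length`, for then its central
reflection is a symmetry of the sequence. Comparing the first letters of the two occurrences, they
are either translates of each other or in mirror position. -/
theorem palindrome_window_periodic (hpal : p.Palindrome) (hm : MirrorDistinct p) {y : List B}
    (hy : y.Palindrome) (hy0 : y ≠ []) {o o' : ℕ} (hoo : o < o')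
    (ho : IsOccurrence (periodic p hp) y o) (ho' : IsOccurrence (periodic p hp) y o')
    (hle : o' + y.length ≤ 2 * p.length)
    (hb : ∀ k, o < k → k < o' → ¬ IsOccurrence (periodic p hp) y k) :
    (window (periodic p hp) o (o' - o + y.length)).Palindrome := by
  have hlen := List.length_pos_iff.2 hy0
  have heq : ∀ t, t < y.length → periodic p hp (o + t) = periodic p hp (o' + t) := by
    intro t ht
    rw [isOccurrence_iff_getElem.1 ho t ht, isOccurrence_iff_getElem.1 ho' t ht]
  have fin : p.length ∣ o + o' + y.length →
      (window (periodic p hp) o (o' - o + y.length)).Palindrome := by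
    intro h
    rw [palindrome_window_iff]
    intro s t hst
    apply periodic_eq_of_dvd hp hpal
    rwa [show o + s + (o + t) + 1 = o + o' + y.length by omega]
  -- The bound `2 * p.length` leaves room for a shift by one period only. The first and last letters
  -- of the palindrome `y` then agree, which gives the divisibility unless `y` is a single letter.
  have shifted : o ≡ o' [MOD p.length] →
      (window (periodic p hp) o (o' - o + y.length)).Palindrome := by
    intro h
    obtain ⟨k, hk⟩ := (Nat.modEq_iff_dvd' hoo.le).1 h
    have hk1 : k = 1 := by
      have h3 : k < 2 := by
        by_contra h4
        have := Nat.mul_le_mul_left p.length (show 2 ≤ k by omega)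
        omega
      have h5 : k ≠ 0 := by rintro rfl; omega
      omega
    subst hk1
    have hpo := hy
    rw [← ho, palindrome_window_iff] at hpo
    have h1 := hpo 0 (y.length - 1) (by omega)
    rcases modEq_or_dvd_of_periodic_eq hp hm h1 with h2 | h2
    · have h3 := (Nat.modEq_iff_dvd' (by omega)).1 h2
      have h4 : y.length = 1 := by
        have := Nat.eq_zero_of_dvd_of_lt h3 (by omega)
        omega
      obtain ⟨c, rfl⟩ := List.length_eq_one_iff.1 h4
      simp only [isOccurrence_singleton, List.length_singleton] at *
      apply fin
      -- A single letter off the centre of `p` would recur at its mirror position, strictly between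
      -- the two occurrences.
      have h5 : 2 * o + 1 = p.length := by
        rcases lt_trichotomy (2 * o + 1) p.length with h6 | h6 | h6
        · refine absurd ?_ (hb (p.length - 1 - o) (by omega) (by omega))
          rw [← ho]
          exact periodic_eq_of_dvd hp hpal ⟨1, by omega⟩
        · exact h6
        · refine absurd ?_ (hb (2 * p.length - 1 - o) (by omega) (by omega))
          rw [← ho]
          exact periodic_eq_of_dvd hp hpal ⟨2, by omega⟩
      exact ⟨2, by omega⟩
    · apply fin
      have := h2.add (dvd_refl p.length)
      rwa [show o + 0 + (o + (y.length - 1)) + 1 + p.length = o + o' + y.length by omega] at this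
  have h0 := heq 0 (by omega)
  rcases modEq_or_dvd_of_periodic_eq hp hm h0 with h | h
  · exact shifted h
  · rcases Nat.lt_or_ge 1 y.length with hl | hl
    · rcases modEq_or_dvd_of_periodic_eq hp hm (heq 1 hl) with h' | h'
      · exact shifted (Nat.ModEq.add_right_cancel' 1 h')
      -- If both the first and the second letters are mirrored, the sums of positions differ by 2,
      -- so the period divides 2 and the sequence is constant.
      · have h2 : p.length ∣ 2 := by
          have := (Nat.dvd_add_right h).1
            (show p.length ∣ (o + 0 + (o' + 0) + 1) + 2 by
              rwa [show o + 0 + (o' + 0) + 1 + 2 = o + 1 + (o' + 1) + 1 by omega])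
          exact this
        rw [palindrome_window_iff]
        intro s t _
        rcases Nat.even_or_odd (s + t) with he | he
        · apply periodic_eq_of_modEq
          refine Nat.ModEq.of_dvd h2 ?_
          rw [Nat.even_iff] at he
          unfold Nat.ModEq
          omega
        · apply periodic_eq_of_dvd hp hpal
          refine h2.trans ?_
          rw [Nat.odd_iff] at he
          omega
    · apply fin
      rwa [show o + o' + y.length = o + 0 + (o' + 0) + 1 by omega]

end periodic

/-! ### The morphism `phi` followed by a code of palindromes -/

/-- The letter following `0` in `phi n i`. -/
def next (n : ℕ) (i : Fin n) : Fin n :=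
  if h : i.val + 1 < n then ⟨i.val + 1, h⟩ else i

/-- The word `phi n i` without its first letter. -/
def phiTail (n : ℕ) (i : Fin n) : List (Fin n) :=
  if i.val + 1 < n then [next n i] else [next n i, next n i]

theorem phi_eq (n : ℕ) [NeZero n] (i : Fin n) : phi n i = 0 :: phiTail n i := by
  unfold phi phiTail next; split <;> simp

theorem val_next {n : ℕ} (i : Fin n) : (next n i).val = min (i.val + 1) (n - 1) := by
  unfold next
  split
  · simp; omega
  · omega

theorem phiTail_palindrome {n : ℕ} (i : Fin n) : (phiTail n i).Palindrome := by
  unfold phiTail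
  rw [palindrome_iff]; split <;> simp

theorem mem_phiTail {n : ℕ} {i b : Fin n} : b ∈ phiTail n i ↔ b = next n i := by
  unfold phiTail; split <;> simp

/-- Palindromes with disjoint sets of letters, which are distinct in the first halves. -/
structure IsMirrorCode {n : ℕ} (π : Fin n → List B) : Prop where
  ne_nil : ∀ i, π i ≠ []
  pal : ∀ i, (π i).Palindrome
  distinct : ∀ i, MirrorDistinct (π i)
  disjoint : ∀ i j, i ≠ j → ∀ b ∈ π i, b ∉ π j

theorem isMirrorCode_singleton (n : ℕ) : IsMirrorCode (fun i : Fin n => [i]) where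
  ne_nil := by simp
  pal i := .singleton i
  distinct i := by
    intro s t hs ht _
    simp at hs ht; omega
  disjoint := by
    intro i j hij b hb
    simp only [List.mem_singleton] at hb ⊢
    rintro rfl
    exact hij hb.symm

/-- Subsingletons and final segments. -/
def IsSegment {n : ℕ} (T : Set (Fin n)) : Prop :=
  T.Subsingleton ∨ ∃ k, T = {i : Fin n | k ≤ i.val}

/-- The palindrome following the marker in the image of `i` under `phi` and `π`. -/
abbrev tailImage {n : ℕ} (π : Fin n → List B) (i : Fin n) : List B := wordImage π (phiTail n i)

section tailImage

variable {n : ℕ} {π : Fin n → List B}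

theorem next_eq_of_common (hπ : IsMirrorCode π) {i i' : Fin n} {b : B} (h : b ∈ tailImage π i)
    (h' : b ∈ tailImage π i') : next n i = next n i' := by
  simp only [tailImage, wordImage, List.mem_flatMap, mem_phiTail] at h h'
  obtain ⟨_, rfl, h⟩ := h
  obtain ⟨_, rfl, h'⟩ := h'
  by_contra hne
  exact hπ.disjoint _ _ hne b h h'

/-- A common letter forces equal values of `next`, which identifies only `n - 2` and `n - 1`. So `T`
is a subsingleton or consists of these two letters. -/
theorem isSegment_of_common (hπ : IsMirrorCode π) {T : Set (Fin n)}
    (h : ∀ i ∈ T, ∀ i' ∈ T, ∃ b, b ∈ tailImage π i ∧ b ∈ tailImage π i') : IsSegment T := by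
  have hnext : ∀ i ∈ T, ∀ i' ∈ T, min (i.val + 1) (n - 1) = min (i'.val + 1) (n - 1) := by
    intro i hi i' hi'
    obtain ⟨b, hb, hb'⟩ := h i hi i' hi'
    rw [← val_next, ← val_next, next_eq_of_common hπ hb hb']
  by_cases hs : T.Subsingleton
  · exact Or.inl hs
  · obtain ⟨i, hi, i', hi', hne⟩ := Set.not_subsingleton_iff.1 hs
    right
    refine ⟨n - 2, ?_⟩
    have hne' : i.val ≠ i'.val := fun h => hne (Fin.ext h)
    have hii := hnext i hi i' hi'
    ext k
    simp only [Set.mem_ofPred_eq]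
    constructor
    · intro hk
      have h1 := hnext i hi k hk
      have := i.isLt; have := i'.isLt; have := k.isLt
      omega
    · intro hk
      have : k.val = i.val ∨ k.val = i'.val := by
        have := i.isLt; have := i'.isLt; have := k.isLt
        omega
      rcases this with h | h
      · rwa [Fin.ext h]
      · rwa [Fin.ext h]

theorem isOccurrence_tailImage (hπ : IsMirrorCode π) {i k : Fin n} (hk : next n i = k) :
    IsOccurrence (periodic (π k) (hπ.ne_nil _)) (tailImage π i) 0 := by
  subst hk
  unfold tailImage phiTail
  split
  · simpa using isOccurrence_periodic (hπ.ne_nil _)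
  · simpa using isOccurrence_periodic_append (hπ.ne_nil _)

theorem length_tailImage (π : Fin n → List B) (i : Fin n) : (tailImage π i).length =
    if i.val + 1 < n then (π (next n i)).length else 2 * (π (next n i)).length := by
  unfold tailImage phiTail
  split
  · simp
  · simp; omega

theorem tailImage_palindrome (hπ : IsMirrorCode π) (i : Fin n) : (tailImage π i).Palindrome := by
  rw [palindrome_iff, reverse_wordImage hπ.pal, (phiTail_palindrome i).reverse_eq]

theorem tailImage_ne_nil (hπ : IsMirrorCode π) (i : Fin n) : tailImage π i ≠ [] := by
  have := List.length_pos_iff.2 (hπ.ne_nil (next n i))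
  rw [← List.length_pos_iff, length_tailImage π]
  split <;> omega

/-- Distinct blocks with a common letter. -/
theorem common_cases (hπ : IsMirrorCode π) {i i' : Fin n} (hne : i ≠ i') (h : next n i = next n i') :
    (tailImage π i <+: tailImage π i' ∧ (tailImage π i).length < (tailImage π i').length) ∨
    (tailImage π i' <+: tailImage π i ∧ (tailImage π i').length < (tailImage π i).length) := by
  have hv := congrArg Fin.val h
  rw [val_next, val_next] at hv
  have hne' : i.val ≠ i'.val := fun h => hne (Fin.ext h)
  have h1 := i.isLt
  have h2 := i'.isLt
  have hpos := List.length_pos_iff.2 (hπ.ne_nil (next n i))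
  have l1 := length_tailImage π i
  have l2 := length_tailImage π i'
  have o1 := isOccurrence_tailImage hπ (i := i) rfl
  have o2 := isOccurrence_tailImage hπ h.symm
  rw [← h] at l2
  rcases Nat.lt_or_gt_of_ne hne' with hlt | hlt
  · left
    rw [if_pos (by omega)] at l1
    rw [if_neg (by omega)] at l2
    exact ⟨o1.prefix_of_length_le o2 (by omega), by omega⟩
  · right
    rw [if_neg (by omega)] at l1
    rw [if_pos (by omega)] at l2
    exact ⟨o2.prefix_of_length_le o1 (by omega), by omega⟩

theorem tailImage_injective (hπ : IsMirrorCode π) : Function.Injective (tailImage π) := by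
  intro i i' h
  by_contra hne
  obtain ⟨b, hb⟩ := List.exists_mem_of_ne_nil _ (tailImage_ne_nil hπ i)
  rcases common_cases hπ hne (next_eq_of_common hπ hb (h ▸ hb)) with h1 | h1
  · rw [h] at h1; omega
  · rw [h] at h1; omega

/-- For `2 ≤ n` the value `0` is never taken by `next`, so disjointness of the code keeps `a` out of
the tails. -/
theorem isMarkedImage_phi (hπ : IsMirrorCode π) [NeZero n] (hn : 2 ≤ n) {a : B} (ha : π 0 = [a]) {u : ℕ → Fin n}
    {v : ℕ → B} (h : IsImage (fun i => wordImage π (phi n i)) u v) :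
    IsMarkedImage a (tailImage π) u v where
  image := by
    convert h using 2 with i
    simp [phi_eq, ha, marked]
  not_mem i h := by
    simp only [tailImage, wordImage, List.mem_flatMap, mem_phiTail] at h
    obtain ⟨_, rfl, h⟩ := h
    refine hπ.disjoint _ 0 ?_ a h (by simp [ha])
    intro h0
    have := congrArg Fin.val h0
    rw [val_next] at this
    simp at this; omega
  pal := tailImage_palindrome hπ
  inj := tailImage_injective hπ

/-- Without a condition on the frame, the markers around `q i` always supply missing neighbours. -/
theorem blockOcc_univ_iff {A : Type*} {a : B} {q : A → List B} {y : List B} {i : A} {o : ℕ} :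
    IsMarkedImage.BlockOcc a q Set.univ y i o ↔
      o + y.length ≤ (q i).length ∧ y <+: (q i).drop o := by
  constructor
  · intro h
    refine ⟨h.add_le, ?_⟩
    have hle := h.add_le
    obtain ⟨b, -, c, -, p, r, rfl, h⟩ := h
    have h1 := congrArg (List.drop (p.length + 1)) h
    have h2 : y <+: (q i ++ [a]).drop p.length := by
      refine ⟨c :: r, ?_⟩
      rw [List.drop_succ_cons] at h1
      rw [h1]
      simp [List.drop_append]
    refine List.prefix_of_prefix_length_le h2
      (show (q i).drop p.length <+: (q i ++ [a]).drop p.length from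
        ⟨[a], by rw [List.drop_append_of_le_length (by omega)]⟩) (by simp; omega)
  · rintro ⟨h1, r, hr⟩
    have hq : q i = (q i).take o ++ (y ++ r) := by rw [hr, List.take_append_drop]
    obtain ⟨c, r', hc⟩ : ∃ c r', r ++ [a] = c :: r' := by
      cases r with
      | nil => exact ⟨a, [], rfl⟩
      | cons c r => exact ⟨c, r ++ [a], rfl⟩
    obtain ⟨p, b, hb⟩ : ∃ p b, a :: (q i).take o = p ++ [b] :=
      ⟨_, _, (List.dropLast_append_getLast (List.cons_ne_nil _ _)).symm⟩
    refine ⟨b, trivial, c, trivial, p, r', ?_, ?_⟩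
    · have := congrArg List.length hb
      simp at this; omega
    · have : a :: (q i ++ [a]) = (a :: (q i).take o) ++ y ++ (r ++ [a]) := by
        conv_lhs => rw [hq]
        simp
      rw [this, hb, hc]; simp

theorem blockOcc_univ_iff_periodic (hπ : IsMirrorCode π) {a : B} {y : List B} {i k : Fin n}
    (hk : next n i = k) {o : ℕ} :
    IsMarkedImage.BlockOcc a (tailImage π) Set.univ y i o ↔
      o + y.length ≤ (tailImage π i).length ∧
        IsOccurrence (periodic (π k) (hπ.ne_nil _)) y o := by
  rw [blockOcc_univ_iff]
  refine and_congr_right fun hle => ?_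
  have h := isOccurrence_tailImage hπ hk
  rw [← List.take_append_drop o (tailImage π i), isOccurrence_append] at h
  have h1 := h.2
  rw [List.length_take, Nat.zero_add, min_eq_left (by omega)] at h1
  exact ⟨h1.of_prefix, fun h2 => h2.prefix_of_length_le h1 (by simp; omega)⟩

/-- One desubstitution step, used both within the induction for `u` and for the final passage to
`π(u)`. Even an unframed `y` leads to framed `x`, so `hret` must cover all segments `T`. -/
theorem palReturns_univ (hπ : IsMirrorCode π) [NeZero n] (hn : 2 ≤ n) {a : B} (ha : π 0 = [a]) {u : ℕ → Fin n}
    {v : ℕ → B} (h : IsImage (fun i => wordImage π (phi n i)) u v)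
    (hgap : ∀ T : Set (Fin n), IsSegment T → PalGaps u T) {y : List B} (hy : y.Palindrome)
    (hret : ∀ T : Set (Fin n), IsSegment T → ∀ x : List (Fin n), x.Palindrome →
      x.length < y.length → PalReturns u T x) :
    PalReturns v Set.univ y := by
  have H := isMarkedImage_phi hπ hn ha h
  by_cases hy0 : y = []
  · subst hy0
    intro j l hjl hj hl hb
    have : l = j + 1 := by
      by_contra hne
      exact hb (j + 1) (by omega) (by omega) (framedOcc_iff.2 ⟨trivial, rfl, trivial⟩)
    subst this
    simpa using List.Palindrome.singleton _
  by_cases hay : a ∈ y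
  · intro j l hjl hj hl hb
    obtain ⟨s, x, hs, hx, rfl⟩ := H.exists_decomposition hy hay (framedOcc_iff.1 hj).2.1
    refine H.palReturns_image hs (hret _ ?_ x hx ?_) j l hjl hj hl hb
    · by_cases hs0 : s = []
      · subst hs0
        right
        refine ⟨0, ?_⟩
        ext i
        simp only [IsMarkedImage.framing, Set.mem_univ, true_and, Set.mem_ofPred_eq, Nat.zero_le,
          iff_true]
        exact ⟨_, _, List.dropLast_append_getLast (marked_ne_nil a _ i)⟩
      · obtain ⟨b, hb⟩ := List.exists_mem_of_ne_nil _ hs0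
        have hmem : ∀ i ∈ IsMarkedImage.framing a (tailImage π) Set.univ s,
            b ∈ tailImage π i := by
          rintro i ⟨c, -, hc⟩
          rcases List.suffix_cons_iff.1 hc with h | h
          · rw [← (List.cons.inj h).2]; exact hb
          · exact h.subset (List.mem_cons_of_mem _ hb)
        exact isSegment_of_common hπ fun i hi i' hi' => ⟨b, hmem i hi, hmem i' hi'⟩
    · have := le_length_wordImage (marked_ne_nil a (tailImage π)) x
      simp only [List.length_append, List.length_singleton]
      omega
  · obtain ⟨b, hb⟩ := List.exists_mem_of_ne_nil _ hy0
    have hmem : ∀ i o, IsMarkedImage.BlockOcc a (tailImage π) Set.univ y i o →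
        b ∈ tailImage π i := by
      intro i o h
      exact List.mem_of_mem_drop ((blockOcc_univ_iff.1 h).2.subset hb)
    refine H.palReturns_of_blockOcc hay (hgap _ ?_) ?_ ?_
    · exact isSegment_of_common hπ fun i ⟨o, hi⟩ i' ⟨o', hi'⟩ =>
        ⟨b, hmem i o hi, hmem i' o' hi'⟩
    · intro i o o' hoo ho ho' hk
      have hle := ho'.add_le
      have hlen := length_tailImage π i
      have hle2 : o' + y.length ≤ 2 * (π (next n i)).length := by
        split at hlen <;> omega
      have := palindrome_window_periodic (hπ.ne_nil _) (hπ.pal _) (hπ.distinct _) hy hy0 hoo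
        ((blockOcc_univ_iff_periodic hπ rfl).1 ho).2 ((blockOcc_univ_iff_periodic hπ rfl).1 ho').2 hle2
        (by
          intro k h1 h2 h3
          exact hk k h1 h2 ((blockOcc_univ_iff_periodic hπ rfl).2 ⟨by omega, h3⟩))
      convert this using 1
      have hq := isOccurrence_tailImage hπ (i := i) rfl
      rw [← List.take_append_drop o (tailImage π i), isOccurrence_append] at hq
      have h2 := hq.2.of_prefix (List.take_prefix (o' - o + y.length) _)
      rw [List.length_take, Nat.zero_add, min_eq_left (by omega)] at h2
      rw [IsOccurrence, List.length_take, List.length_drop, min_eq_left (by omega)] at h2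
      exact h2.symm
    -- Tails with a common letter are prefixes of one periodic sequence, so `y` occurs first at the
    -- same place in both.
    · have key : ∀ i i' o o', tailImage π i <+: tailImage π i' →
          IsMarkedImage.BlockOcc a (tailImage π) Set.univ y i o →
          (∀ k, k < o → ¬ IsMarkedImage.BlockOcc a (tailImage π) Set.univ y i k) →
          IsMarkedImage.BlockOcc a (tailImage π) Set.univ y i' o' →
          (∀ k, k < o' → ¬ IsMarkedImage.BlockOcc a (tailImage π) Set.univ y i' k) →
          next n i = next n i' →
          (tailImage π i).take (o + y.length) = (tailImage π i').take (o' + y.length) := by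
        intro i i' o o' hpre h1 h2 h3 h4 hnext
        have hle := h1.add_le
        have hlen := hpre.length_le
        have e := fun o => blockOcc_univ_iff_periodic hπ (a := a) (y := y) (o := o) hnext
        have e' := fun o => blockOcc_univ_iff_periodic hπ (a := a) (y := y) (i := i') (o := o) rfl
        have : o = o' := by
          rcases lt_trichotomy o o' with h | h | h
          · exact absurd ((e' _).2 ⟨by omega, ((e _).1 h1).2⟩) (h4 o h)
          · exact h
          · exact absurd ((e _).2 ⟨by omega, ((e' _).1 h3).2⟩) (h2 o' h)
        subst this
        obtain ⟨t, ht⟩ := hpre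
        rw [← ht, List.take_append_of_le_length hle]
      refine IsMarkedImage.drop_eq_of_first hy H.pal ?_
      intro i i' o o' hne h1 h2 h3 h4
      have hnext := next_eq_of_common hπ (hmem i o h1) (hmem i' o' h3)
      rcases common_cases hπ hne hnext with h | h
      · exact key i i' o o' h.1 h1 h2 h3 h4 hnext
      · exact (key i' i o' o h.1 h3 h4 h1 h2 hnext.symm).symm

end tailImage

/-! ### Palindromic returns in the fixed point of `phi` -/

theorem isImage_uSeq (n : ℕ) [NeZero n] (hn : 2 ≤ n) : IsImage (phi n) (uSeq n) (uSeq n) := by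
  have := isImage_seqImage (phi n) (phi_ne_nil n) (uSeq n)
  rwa [(seqImage_eq_self_iff n hn _).2 rfl] at this

theorem wordImage_singleton {A : Type*} (w : List A) : wordImage (fun i => [i]) w = w := by
  induction w with
  | nil => rfl
  | cons a w ih => simp [ih]

theorem tailImage_singleton (n : ℕ) : tailImage (fun i : Fin n => [i]) = phiTail n :=
  funext fun _ => wordImage_singleton _

section fixedPoint

variable {n : ℕ} [NeZero n]

theorem isMarkedImage_uSeq (hn : 2 ≤ n) :
    IsMarkedImage 0 (phiTail n) (uSeq n) (uSeq n) := by
  rw [← tailImage_singleton]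
  refine isMarkedImage_phi (isMirrorCode_singleton n) hn rfl ?_
  simpa only [wordImage_singleton] using isImage_uSeq n hn

theorem phiTail_ne_nil {n : ℕ} (i : Fin n) : phiTail n i ≠ [] := by
  unfold phiTail; split <;> simp

/-- The tail of `i` repeats the letter `next n i`, so gaps for `T` reduce to gaps for its preimage
under `next`. -/
theorem palGaps_of_next (hn : 2 ≤ n) {T T₀ : Set (Fin n)} (h0 : (0 : Fin n) ∉ T)
    (hT : ∀ i, next n i ∈ T ↔ i ∈ T₀) (h : PalGaps (uSeq n) T₀) : PalGaps (uSeq n) T := by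
  have key : ∀ i (t : ℕ) (ht : t < (phiTail n i).length), (phiTail n i)[t] = next n i :=
    fun i t ht => mem_phiTail.1 (List.getElem_mem ht)
  refine (isMarkedImage_uSeq hn).palGaps_image h0 ?_ ?_ phiTail_ne_nil h
  · intro i t ht h1
    rw [key] at h1
    exact (hT i).1 h1
  · intro i hi t ht
    rw [key]
    exact (hT i).2 hi

theorem palGaps_of_forall_notMem {A : Type*} {u : ℕ → A} {T : Set A} (h : ∀ i, i ∉ T) :
    PalGaps u T := fun _ _ _ hj => absurd hj (h _)

theorem palGaps_final (hn : 2 ≤ n) (k : ℕ) : PalGaps (uSeq n) {i | k ≤ i.val} := by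
  induction k with
  | zero =>
    intro j l hjl _ _ hb
    have : l = j + 1 := by
      by_contra hne
      exact hb (j + 1) (by omega) (by omega) (Nat.zero_le _)
    subst this
    simpa using List.Palindrome.nil
  | succ k ih =>
    by_cases hk : k + 1 < n
    · refine palGaps_of_next hn (by simp) (fun i => ?_) ih
      simp only [Set.mem_ofPred_eq, val_next]
      omega
    · refine palGaps_of_forall_notMem fun i => ?_
      simp only [Set.mem_ofPred_eq]
      omega

/-- The preimage of `c + 1` under `next` is `c` alone, except for the last letter, whose singleton
is a final segment. -/
theorem palGaps_singleton (hn : 2 ≤ n) (c : ℕ) (hc : c < n) :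
    PalGaps (uSeq n) {(⟨c, hc⟩ : Fin n)} := by
  induction c with
  | zero => exact (isMarkedImage_uSeq hn).palGaps_marker
  | succ c ih =>
    by_cases hl : c + 2 < n
    · refine palGaps_of_next hn (by simp [Fin.ext_iff]) (fun i => ?_) (ih (by omega))
      simp only [Set.mem_singleton_iff, Fin.ext_iff, val_next]
      omega
    · convert palGaps_final hn (c + 1) using 1
      ext i
      have := i.isLt
      simp only [Set.mem_singleton_iff, Fin.ext_iff, Set.mem_ofPred_eq]
      omega

theorem palGaps_uSeq (hn : 2 ≤ n) {T : Set (Fin n)} (hT : IsSegment T) : PalGaps (uSeq n) T := by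
  rcases hT with hT | ⟨k, rfl⟩
  · rcases hT.eq_empty_or_singleton with rfl | ⟨c, rfl⟩
    · exact palGaps_of_forall_notMem fun i => by simp
    · exact palGaps_singleton hn c.val c.isLt
  · exact palGaps_final hn k

theorem next_mem_of_suffix {i b : Fin n} (h : [b] <:+ marked 0 (phiTail n) i) : b = next n i := by
  rcases List.suffix_cons_iff.1 h with h | h
  · exact absurd (List.cons.inj h).2.symm (phiTail_ne_nil i)
  · exact mem_phiTail.1 (h.subset (by simp))

/-- For nonempty `s` the tails concerned share a letter. For empty `s` only the last letter `next n
i` of the block matters, and a final segment from `k < n` is pulled back to the one from `k - 1`,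
truncated at `0`. -/
theorem isSegment_framing {T : Set (Fin n)} (hT : IsSegment T) (s : List (Fin n)) :
    IsSegment (IsMarkedImage.framing 0 (phiTail n) T s) := by
  have common : ∀ {b : Fin n} {R : Set (Fin n)}, (∀ i ∈ R, b ∈ phiTail n i) → IsSegment R := by
    intro b R hb
    refine isSegment_of_common (isMirrorCode_singleton n) fun i hi i' hi' => ⟨b, ?_, ?_⟩
    · rw [tailImage, wordImage_singleton]; exact hb i hi
    · rw [tailImage, wordImage_singleton]; exact hb i' hi'
  by_cases hs : s = []
  · subst hs
    rcases hT with hT | ⟨k, rfl⟩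
    · rcases hT.eq_empty_or_singleton with rfl | ⟨c, rfl⟩
      · left
        rintro i ⟨b, hb, -⟩
        exact absurd hb (by simp)
      · refine common (b := c) ?_
        rintro i ⟨b, rfl, hb⟩
        exact mem_phiTail.2 (next_mem_of_suffix hb)
    · by_cases hk : k < n
      · right
        refine ⟨k - 1, ?_⟩
        ext i
        have hi := i.isLt
        constructor
        · rintro ⟨b, hb, h⟩
          rw [next_mem_of_suffix h] at hb
          simp only [Set.mem_ofPred_eq, val_next] at hb ⊢
          omega
        · intro h
          refine ⟨next n i, ?_, ?_⟩
          · simp only [Set.mem_ofPred_eq, val_next] at h ⊢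
            omega
          · refine (?_ : [next n i] <:+ phiTail n i).trans (List.suffix_cons _ _)
            unfold phiTail
            split
            · exact List.suffix_rfl
            · exact List.suffix_cons _ _
      · left
        rintro i ⟨b, hb, -⟩
        have := b.isLt
        simp only [Set.mem_ofPred_eq] at hb
        omega
  · obtain ⟨b, hb⟩ := List.exists_mem_of_ne_nil _ hs
    refine common (b := b) ?_
    rintro i ⟨c, -, hc⟩
    rcases List.suffix_cons_iff.1 hc with h | h
    · rw [← (List.cons.inj h).2]; exact hb
    · exact h.subset (List.mem_cons_of_mem _ hb)

/-- A proper segment contains no letter but `0`, or omits `0`. In the first case both frames are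
markers and `y` is a whole tail. In the second neither is, so the tail has two letters: `i` is the
last letter and `y` is empty. -/
theorem blockOcc_unique (hn : 2 ≤ n) {T : Set (Fin n)} (hT : IsSegment T) (hT' : T ≠ Set.univ)
    {y : List (Fin n)} {i i' : Fin n} {o o' : ℕ}
    (h : IsMarkedImage.BlockOcc 0 (phiTail n) T y i o)
    (h' : IsMarkedImage.BlockOcc 0 (phiTail n) T y i' o') : i = i' ∧ o = o' := by
  have hcases : (∀ b ∈ T, b = 0) ∨ (0 : Fin n) ∉ T := by
    by_cases h0 : (0 : Fin n) ∈ T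
    · left
      rcases hT with hT | ⟨k, rfl⟩
      · exact fun b hb => hT hb h0
      · refine absurd ?_ hT'
        have : k = 0 := by simpa using h0
        subst this
        ext; simp
    · exact Or.inr h0
  have hnm := (isMarkedImage_uSeq hn).not_mem
  have letters : ∀ {i o}, IsMarkedImage.BlockOcc 0 (phiTail n) T y i o →
      (∃ b ∈ T, (0 :: (phiTail n i ++ [0]))[o]? = some b) ∧
      (∃ c ∈ T, (0 :: (phiTail n i ++ [0]))[o + 1 + y.length]? = some c) := by
    rintro i o ⟨b, hb, c, hc, p, r, rfl, h⟩
    refine ⟨⟨b, hb, ?_⟩, ⟨c, hc, ?_⟩⟩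
    · rw [h]; simp
    · rw [h, List.append_assoc, List.getElem?_append_right (by omega),
        show p.length + 1 + y.length - p.length = y.length + 1 by omega]
      simp
  rcases hcases with h0 | h0
  · have key : ∀ {i o}, IsMarkedImage.BlockOcc 0 (phiTail n) T y i o →
        o = 0 ∧ y = phiTail n i := by
      intro i o h
      have hle := h.add_le
      obtain ⟨⟨b, hb, hb'⟩, c, hc, hc'⟩ := letters h
      have ho : o = 0 := by
        rcases o with _ | o
        · rfl
        · rw [h0 b hb, List.getElem?_cons_succ, List.getElem?_append_left (by omega)] at hb'
          exact absurd (List.mem_of_getElem? hb') (hnm i)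
      subst ho
      have hl : y.length = (phiTail n i).length := by
        by_contra hne
        rw [h0 c hc, show 0 + 1 + y.length = y.length + 1 by omega, List.getElem?_cons_succ,
          List.getElem?_append_left (by omega)] at hc'
        exact absurd (List.mem_of_getElem? hc') (hnm i)
      obtain ⟨b, -, c, -, p, r, hp, h⟩ := h
      rw [List.length_eq_zero_iff] at hp
      subst hp
      simp only [List.nil_append, List.cons_append, List.cons.injEq, List.append_assoc] at h
      exact ⟨rfl, (List.append_inj h.2 hl.symm).1.symm⟩
    obtain ⟨h1, h2⟩ := key h
    obtain ⟨h1', h2'⟩ := key h'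
    exact ⟨(isMarkedImage_uSeq hn).inj (h2.symm.trans h2'), by omega⟩
  · have key : ∀ {i o}, IsMarkedImage.BlockOcc 0 (phiTail n) T y i o →
        o = 1 ∧ i.val + 1 = n := by
      intro i o h
      have hle := h.add_le
      obtain ⟨⟨b, hb, hb'⟩, c, hc, hc'⟩ := letters h
      have ho : o ≠ 0 := by
        rintro rfl
        rw [List.getElem?_cons_zero, Option.some_inj] at hb'
        exact h0 (hb' ▸ hb)
      have hl : o + y.length ≠ (phiTail n i).length := by
        intro he
        rw [show o + 1 + y.length = (phiTail n i).length + 1 by omega] at hc'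
        simp at hc'
        exact h0 (hc' ▸ hc)
      have hi := i.isLt
      unfold phiTail at hle hl
      split at hle
      · simp_all; omega
      · simp_all; omega
    obtain ⟨h1, h2⟩ := key h
    obtain ⟨h1', h2'⟩ := key h'
    exact ⟨Fin.ext (by omega), by omega⟩

/-- Strong induction on the length of `y`, with `T` varying: each desubstitution shortens `y` and
replaces `T` by another segment. -/
theorem palReturns_uSeq (hn : 2 ≤ n) {T : Set (Fin n)} (hT : IsSegment T) {y : List (Fin n)}
    (hy : y.Palindrome) : PalReturns (uSeq n) T y := by
  have H := isMarkedImage_uSeq hn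
  induction hN : y.length using Nat.strong_induction_on generalizing T y with
  | _ N ih =>
  subst hN
  have ih' : ∀ T : Set (Fin n), IsSegment T → ∀ x : List (Fin n), x.Palindrome →
      x.length < y.length → PalReturns (uSeq n) T x :=
    fun T hT x hx hl => ih _ hl hT hx rfl
  by_cases hT' : T = Set.univ
  · subst hT'
    refine palReturns_univ (isMirrorCode_singleton n) hn rfl ?_ (fun T => palGaps_uSeq hn) hy ih'
    simpa only [wordImage_singleton] using isImage_uSeq n hn
  by_cases h0 : 0 ∈ y
  · intro j l hjl hj hl hb
    obtain ⟨s, x, hs, hx, rfl⟩ := H.exists_decomposition hy h0 (framedOcc_iff.1 hj).2.1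
    refine H.palReturns_image hs (ih' _ (isSegment_framing hT s) x hx ?_) j l hjl hj hl hb
    have := le_length_wordImage (marked_ne_nil 0 (phiTail n)) x
    simp only [List.length_append, List.length_singleton]
    omega
  · refine H.palReturns_of_blockOcc h0 (palGaps_uSeq hn (Or.inl ?_)) ?_ ?_
    · rintro i ⟨o, h⟩ i' ⟨o', h'⟩
      exact (blockOcc_unique hn hT hT' h h').1
    · intro i o o' hoo h h'
      exact absurd (blockOcc_unique hn hT hT' h h').2 hoo.ne
    · refine IsMarkedImage.drop_eq_of_first hy H.pal ?_
      intro i i' o o' hne h _ h'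
      exact absurd (blockOcc_unique hn hT hT' h h').1 hne

/-- Consecutive occurrences of a palindrome in the image of the fixed point span a palindrome. -/
theorem palReturns_image_uSeq {B : Type*} (hn : 2 ≤ n) {π : Fin n → List B}
    (hπ : IsMirrorCode π) {a : B} (ha : π 0 = [a]) {v : ℕ → B} (h : IsImage π (uSeq n) v)
    {y : List B} (hy : y.Palindrome) : PalReturns v Set.univ y :=
  palReturns_univ hπ hn ha ((isImage_uSeq n hn).comp h) (fun _ => palGaps_uSeq hn) hy
    fun _ hT _ hx _ => palReturns_uSeq hn hT hx

end fixedPoint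

/-! ### Richness -/

theorem finite_palindromicFactors (w : List B) : {p | p <:+: w ∧ p.Palindrome}.Finite := by
  refine (List.finite_toSet w.sublists).subset ?_
  rintro p ⟨h, -⟩
  exact List.mem_sublists.2 h.sublist

theorem exists_longest_palindromic_suffix (w : List B) (b : B) :
    ∃ y, y <:+ w ++ [b] ∧ y.Palindrome ∧ y ≠ [] ∧
      ∀ y', y' <:+ w ++ [b] → y'.Palindrome → y'.length ≤ y.length := by
  classical
  let P : ℕ → Prop := fun k => ∃ y, y <:+ w ++ [b] ∧ y.Palindrome ∧ y.length = k
  have h1 : P 1 := ⟨[b], List.suffix_append _ _, .singleton b, rfl⟩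
  have hle : 1 ≤ w.length + 1 := by omega
  obtain ⟨y, hy1, hy2, hy3⟩ := Nat.findGreatest_spec hle h1
  refine ⟨y, hy1, hy2, ?_, ?_⟩
  · have := Nat.le_findGreatest hle h1
    rw [← List.length_pos_iff]
    omega
  · intro y' h h'
    rw [hy3]
    exact Nat.le_findGreatest (by simpa using h.length_le) ⟨y', h, h', rfl⟩

/-- The longest palindromic suffix of `w ++ [b]` is new, since an earlier occurrence would yield a
longer one through its palindromic return. The condition `1 ≤ J` provides the left frame letter that
`FramedOcc` demands. -/
theorem isRichWord_of_palReturns {v : ℕ → B}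
    (hv : ∀ y : List B, y.Palindrome → PalReturns v Set.univ y) {w : List B} {J : ℕ}
    (hJ : 1 ≤ J) (hw : IsOccurrence v w J) : IsRichWord w := by
  classical
  induction w using List.reverseRecOn with
  | nil =>
    have : {p : List B | p <:+: [] ∧ p.Palindrome} = {[]} := by
      ext p
      simp only [List.infix_nil, Set.mem_ofPred_eq, Set.mem_singleton_iff]
      exact ⟨fun h => h.1, fun h => ⟨h, h ▸ .nil⟩⟩
    rw [IsRichWord, this]; simp
  | append_singleton w b ih =>
    have ih := ih (isOccurrence_append.1 hw).1
    obtain ⟨y, hsuf, hpal, hne, hmax⟩ := exists_longest_palindromic_suffix w b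
    have hpos := List.length_pos_iff.2 hne
    have hset : {p | p <:+: w ++ [b] ∧ p.Palindrome} =
        insert y {p | p <:+: w ∧ p.Palindrome} := by
      ext p
      simp only [Set.mem_ofPred_eq, Set.mem_insert_iff]
      constructor
      · rintro ⟨h1, h2⟩
        rcases List.infix_concat_iff.1 h1 with h | h
        · by_cases hl : p.length = y.length
          · left
            exact (List.suffix_of_suffix_length_le h hsuf hl.le).eq_of_length hl
          · right
            refine ⟨?_, h2⟩
            have h3 := hmax p h h2
            have h4 := List.suffix_of_suffix_length_le h hsuf h3
            -- A shorter palindromic suffix is also a prefix of the palindrome `y`, so it already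
            -- occurs in `w`.
            have h5 : p <+: y := by
              rw [← List.reverse_suffix, h2.reverse_eq, hpal.reverse_eq]
              exact h4
            obtain ⟨z, hz⟩ := h5
            have hz0 : z ≠ [] := by
              rintro rfl
              simp at hz
              exact hl (by rw [hz])
            obtain ⟨z', c, rfl⟩ : ∃ z' c, z = z' ++ [c] :=
              ⟨_, _, (List.dropLast_append_getLast hz0).symm⟩
            obtain ⟨p', hp'⟩ := hsuf
            rw [← hz, ← List.append_assoc, ← List.append_assoc] at hp'
            have := (List.append_inj' hp' rfl).1
            exact ⟨p', z', this⟩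
        · exact Or.inr ⟨h, h2⟩
      · rintro (rfl | ⟨h1, h2⟩)
        · exact ⟨hsuf.isInfix, hpal⟩
        · exact ⟨h1.trans (List.prefix_append _ _).isInfix, h2⟩
    have hnot : y ∉ {p | p <:+: w ∧ p.Palindrome} := by
      rintro ⟨⟨p, r, hpr⟩, -⟩
      obtain ⟨p', hp'⟩ := hsuf
      have hlen := congrArg List.length hp'
      have hlen' := congrArg List.length hpr
      simp only [List.length_append, List.length_singleton] at hlen hlen'
      have o1 : IsOccurrence v y (J + p.length) := by
        have := (isOccurrence_append.1 hw).1
        rw [← hpr, isOccurrence_append, isOccurrence_append] at this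
        exact this.1.2
      have o2 : IsOccurrence v y (J + p'.length) := by
        rw [← hp', isOccurrence_append] at hw
        exact hw.2
      set l := J + p'.length with hl
      have hle : J + p.length ≤ l - 1 := by omega
      -- The last occurrence before `l`, making `k` and `l` consecutive; `FramedOcc` is then applied
      -- one position to the left.
      obtain ⟨k, hk⟩ : ∃ k, Nat.findGreatest (fun k => IsOccurrence v y k) (l - 1) = k := ⟨_, rfl⟩
      have ok : IsOccurrence v y k := hk ▸ Nat.findGreatest_spec hle o1
      have hk1 : J + p.length ≤ k := hk ▸ Nat.le_findGreatest hle o1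
      have hk2 : k ≤ l - 1 := hk ▸ Nat.findGreatest_le _
      have hp := hv y hpal (k - 1) (l - 1) (by omega)
        (framedOcc_iff.2 ⟨trivial, by rwa [Nat.sub_add_cancel (by omega)], trivial⟩)
        (framedOcc_iff.2 ⟨trivial, by rwa [Nat.sub_add_cancel (by omega)], trivial⟩) (by
          intro i h1 h2 h3
          have := Nat.le_findGreatest (P := fun k => IsOccurrence v y k)
            (show i + 1 ≤ l - 1 by omega) (framedOcc_iff.1 h3).2.1
          omega)
      have hs : window v (k - 1 + 1) (l - 1 - (k - 1) + y.length) <:+ w ++ [b] := by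
        refine ⟨window v J (k - J), ?_⟩
        rw [← hw, List.length_append, List.length_singleton, ← hlen]
        conv_rhs => rw [show p'.length + y.length =
          (k - J) + (l - 1 - (k - 1) + y.length) by omega, window_append]
        congr 2
        omega
      have := hmax _ hs hp
      rw [length_window] at this
      omega
    rw [IsRichWord, hset, Set.ncard_insert_of_notMem hnot (finite_palindromicFactors w), ih]
    simp

/-- The fixed point of `phi` is recurrent. -/
theorem exists_occ_window_uSeq {n : ℕ} [NeZero n] (hn : 2 ≤ n) (k : ℕ) :
    ∃ p, 1 ≤ p ∧ IsOccurrence (uSeq n) (window (uSeq n) 0 k) p := by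
  have H := isMarkedImage_uSeq (n := n) hn
  induction k with
  | zero => exact ⟨1, le_rfl, rfl⟩
  | succ k ih =>
    rcases k with _ | k
    -- Length one is treated apart: applying `phi` at least doubles a prefix, which gains nothing
    -- from the empty one.
    · refine ⟨blockStart (marked 0 (phiTail n)) (uSeq n) 1,
        IsMarkedImage.start_lt_succ (a := 0) (q := phiTail n) (u := uSeq n) 0, ?_⟩
      rw [Nat.zero_add, window_one, isOccurrence_singleton, H.apply_start]
      exact (H.apply_start 0).symm
    · obtain ⟨p, hp, h⟩ := ih
      have himg := isImage_uSeq n hn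
      refine ⟨blockStart (phi n) (uSeq n) p, ?_, ?_⟩
      · exact Nat.lt_of_le_of_lt (Nat.zero_le _) (blockStart_strictMono (phi_ne_nil n) (uSeq n) hp)
      · refine (himg.occ_wordImage h).of_prefix ?_
        have h2 := two_mul_length_le n (window (uSeq n) 0 (k + 1))
        rw [length_window] at h2
        refine IsOccurrence.prefix_of_length_le (u := uSeq n) (j := 0)
          (isOccurrence_window _ _ _) (himg (k + 1)) ?_
        rw [length_window]; omega

/-- Recurrence of `uSeq n` moves any factor, even one starting at position `0`, to an occurrence
with a letter on its left. -/
theorem isRichSeq_image_uSeq {B : Type*} {n : ℕ} [NeZero n] (hn : 2 ≤ n) {π : Fin n → List B}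
    (hπ : IsMirrorCode π) {a : B} (ha : π 0 = [a]) {v : ℕ → B} (h : IsImage π (uSeq n) v) :
    IsRichSeq v := by
  rintro w ⟨j, hj⟩
  obtain ⟨p, hp, ho⟩ := exists_occ_window_uSeq (n := n) hn (j + w.length)
  have hv := h.occ_wordImage ho
  have hle := le_length_wordImage hπ.ne_nil (window (uSeq n) 0 (j + w.length))
  rw [length_window] at hle
  have hpre : window v 0 (j + w.length) <+: wordImage π (window (uSeq n) 0 (j + w.length)) :=
    IsOccurrence.prefix_of_length_le (u := v) (j := 0)
      (isOccurrence_window _ _ _) (h _) (by rwa [length_window])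
  have hv' := hv.of_prefix hpre
  rw [window_append, Nat.zero_add, hj, isOccurrence_append] at hv'
  refine isRichWord_of_palReturns (fun y hy => palReturns_image_uSeq hn hπ ha h hy) ?_ hv'.2
  have := blockStart_strictMono hπ.ne_nil (uSeq n) (show 0 < p from hp)
  omega

/-! ### Bispecial factors and return words -/

section sync

variable {n : ℕ} {π : Fin n → List B}

theorem IsMirrorCode.eq_of_common (hπ : IsMirrorCode π) {i j : Fin n} {b : B} (h : b ∈ π i)
    (h' : b ∈ π j) : i = j := by
  by_contra hne
  exact hπ.disjoint i j hne b h h'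

theorem IsMirrorCode.wordImage_injective (hπ : IsMirrorCode π) :
    Function.Injective (wordImage π) := by
  intro x
  induction x with
  | nil =>
    intro x' h
    cases x' with
    | nil => rfl
    | cons i x' => simp [hπ.ne_nil] at h
  | cons i x ih =>
    intro x' h
    cases x' with
    | nil => simp [hπ.ne_nil] at h
    | cons i' x' =>
      rw [wordImage_cons, wordImage_cons] at h
      obtain ⟨b, r, hb⟩ := List.exists_cons_of_ne_nil (hπ.ne_nil i)
      obtain ⟨b', r', hb'⟩ := List.exists_cons_of_ne_nil (hπ.ne_nil i')
      have hbb : b = b' := by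
        rw [hb, hb'] at h
        exact (List.cons.inj h).1
      obtain rfl : i = i' := hπ.eq_of_common (b := b) (by simp [hb]) (by simp [hb', hbb])
      rw [ih (List.append_cancel_left h)]

theorem IsMirrorCode.palindrome_iff (hπ : IsMirrorCode π) {p : List (Fin n)} :
    p.Palindrome ↔ (wordImage π p).Palindrome := by
  rw [RichWords.palindrome_iff, RichWords.palindrome_iff, reverse_wordImage hπ.pal,
    hπ.wordImage_injective.eq_iff]

variable {u : ℕ → Fin n} {v : ℕ → B}

/-- Two consecutive letters of `π(u)` determine the place of the first in its block. -/
theorem sync_of_two (hπ : IsMirrorCode π) (h : IsImage π u v)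
    (hsq : ∀ m, u m = u (m + 1) → 2 < (π (u m)).length) {m m' o o' : ℕ}
    (ho : o < (π (u m)).length) (ho' : o' < (π (u m')).length)
    (e₀ : v (blockStart π u m + o) = v (blockStart π u m' + o'))
    (e₁ : v (blockStart π u m + o + 1) = v (blockStart π u m' + o' + 1)) :
    u m = u m' ∧ o = o' := by
  -- Mirror positions move in opposite directions, so their successors differ inside the block. If
  -- `o'` is last, then `o = 0` and equal successors would give a squared letter with image of
  -- length 2.
  have main : ∀ {m m' o o' : ℕ}, o < (π (u m)).length → o' < (π (u m')).length → u m = u m' →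
      o < o' → v (blockStart π u m + o + 1) = v (blockStart π u m' + o' + 1) →
      o + o' + 1 ≠ (π (u m)).length := by
    intro m m' o o' ho ho' hu hlt e₁ hsum
    have h1 := h.apply_block (show o + 1 < (π (u m)).length by rw [hu]; omega)
    rw [← Nat.add_assoc, e₁] at h1
    by_cases hl : o' + 1 < (π (u m')).length
    · have h2 := h.apply_block hl
      rw [← Nat.add_assoc, h1] at h2
      simp only [hu] at h2
      rcases hπ.distinct _ _ _ _ _ h2 with h3 | h3 <;> rw [hu] at hsum <;> omega
    · have h2 := h.apply_block (m := m' + 1) (o := 0) (List.length_pos_iff.2 (hπ.ne_nil _))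
      rw [blockStart_succ, show blockStart π u m' + (π (u m')).length + 0 =
        blockStart π u m' + o' + 1 by omega, h1] at h2
      have h3 : u m = u (m' + 1) := hπ.eq_of_common (h2 ▸ List.getElem_mem _) (List.getElem_mem _)
      have h4 := hsq m' (hu.symm.trans h3)
      simp only [← h3] at h2
      rw [← hu] at h4 hl
      rcases hπ.distinct _ _ _ _ _ h2 with h5 | h5 <;> omega
  have h1 := h.apply_block ho
  have h2 := h.apply_block ho'
  rw [e₀, h2] at h1
  have hu : u m = u m' := hπ.eq_of_common (List.getElem_mem _) (h1 ▸ List.getElem_mem _)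
  refine ⟨hu, ?_⟩
  simp only [hu] at h1
  rcases hπ.distinct _ _ _ _ _ h1 with h3 | h3
  · exact h3.symm
  · rcases lt_trichotomy o o' with hlt | heq | hlt
    · exact absurd (by rw [hu]; omega) (main ho ho' hu hlt e₁)
    · exact heq
    · exact absurd h3 (main ho' ho hu.symm hlt e₁.symm)

/-- Meant for the last letter of a word: having no successor within the word, it inherits its place
from its predecessor. -/
theorem sync_step (hπ : IsMirrorCode π) (h : IsImage π u v) {m m' o : ℕ}
    (ho : o < (π (u m)).length) (hu : u m = u m')
    (e₁ : v (blockStart π u m + o + 1) = v (blockStart π u m' + o + 1)) :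
    ∃ k k' s, s < (π (u k)).length ∧ u k = u k' ∧
      blockStart π u m + o + 1 = blockStart π u k + s ∧
      blockStart π u m' + o + 1 = blockStart π u k' + s := by
  by_cases hl : o + 1 < (π (u m)).length
  · exact ⟨m, m', o + 1, hl, hu, rfl, rfl⟩
  · have p1 : blockStart π u m + o + 1 = blockStart π u (m + 1) + 0 := by
      rw [blockStart_succ]; omega
    have p2 : blockStart π u m' + o + 1 = blockStart π u (m' + 1) + 0 := by
      rw [blockStart_succ, ← hu]; omega
    refine ⟨m + 1, m' + 1, 0, List.length_pos_iff.2 (hπ.ne_nil _), ?_, p1, p2⟩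
    rw [p1, p2, h.apply_block (List.length_pos_iff.2 (hπ.ne_nil _)),
      h.apply_block (List.length_pos_iff.2 (hπ.ne_nil _))] at e₁
    exact hπ.eq_of_common (e₁ ▸ List.getElem_mem _) (List.getElem_mem _)

/-- Two occurrences of a word of length at least two meet the blocks in the same way. -/
theorem sync_of_occ (hπ : IsMirrorCode π) (h : IsImage π u v)
    (hsq : ∀ m, u m = u (m + 1) → 2 < (π (u m)).length) {w : List B} (hw : 1 < w.length)
    {p p' : ℕ} (hp : IsOccurrence v w p) (hp' : IsOccurrence v w p') {t : ℕ}
    (ht : t < w.length) :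
    ∃ k k' s, s < (π (u k)).length ∧ u k = u k' ∧
      p + t = blockStart π u k + s ∧ p' + t = blockStart π u k' + s := by
  have heq : ∀ t, t < w.length → v (p + t) = v (p' + t) := by
    intro t ht
    rw [isOccurrence_iff_getElem.1 hp t ht, isOccurrence_iff_getElem.1 hp' t ht]
  have early : ∀ t, t + 1 < w.length → ∃ k k' s, s < (π (u k)).length ∧ u k = u k' ∧
      p + t = blockStart π u k + s ∧ p' + t = blockStart π u k' + s := by
    intro t ht
    obtain ⟨m, o, e, ho⟩ := exists_block hπ.ne_nil u (p + t)
    obtain ⟨m', o', e', ho'⟩ := exists_block hπ.ne_nil u (p' + t)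
    have e₁ := heq (t + 1) ht
    rw [← Nat.add_assoc, ← Nat.add_assoc, e, e'] at e₁
    have e₀ := heq t (by omega)
    rw [e, e'] at e₀
    obtain ⟨h1, rfl⟩ := sync_of_two hπ h hsq ho ho' e₀ e₁
    exact ⟨m, m', o, ho, h1, e, e'⟩
  by_cases hl : t + 1 < w.length
  · exact early t hl
  · rcases t with _ | t
    · omega
    · obtain ⟨m, m', o, ho, hu, e, e'⟩ := early t ht
      have e₁ := heq (t + 1) ht
      rw [← Nat.add_assoc, ← Nat.add_assoc, e, e'] at e₁
      have := sync_step hπ h ho hu e₁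
      rwa [← e, ← e'] at this

/-- Every occurrence of a left special factor starts at a block boundary. -/
theorem exists_start_of_leftSpecial (hπ : IsMirrorCode π) (h : IsImage π u v)
    (hsq : ∀ m, u m = u (m + 1) → 2 < (π (u m)).length) {w : List B} (hw : 1 < w.length)
    (hs : IsLeftSpecial v w) {p : ℕ} (hp : IsOccurrence v w p) :
    ∃ m, p = blockStart π u m := by
  obtain ⟨-, b, c, hbc, ⟨j, hj⟩, ⟨l, hl⟩⟩ := hs
  rw [isOccurrence_cons] at hj hl
  obtain ⟨k, k', s, hs, hu, e, e'⟩ := sync_of_occ hπ h hsq hw hj.2 hl.2 (t := 0) (by omega)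
  obtain ⟨k₁, k₂, s', hs', hu', e₁, e₂⟩ := sync_of_occ hπ h hsq hw hj.2 hp (t := 0) (by omega)
  obtain ⟨rfl, rfl⟩ := block_unique hπ.ne_nil (e.symm.trans e₁) hs hs'
  rcases s with _ | s
  · exact ⟨k₂, by omega⟩
  -- Inside a block, the preceding letter is determined by the block, so there is only one left
  -- extension.
  · refine absurd ?_ hbc
    rw [← hj.1, ← hl.1, show j = blockStart π u k + s by omega,
      show l = blockStart π u k' + s by omega, h.apply_block (by omega),
      h.apply_block (by rw [← hu]; omega)]
    simp only [hu]

/-- Every occurrence of a right special factor ends at a block boundary. -/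
theorem exists_end_of_rightSpecial (hπ : IsMirrorCode π) (h : IsImage π u v)
    (hsq : ∀ m, u m = u (m + 1) → 2 < (π (u m)).length) {w : List B} (hw : 1 < w.length)
    (hs : IsRightSpecial v w) {p : ℕ} (hp : IsOccurrence v w p) :
    ∃ m, p + w.length = blockStart π u m := by
  obtain ⟨-, b, c, hbc, ⟨j, hj⟩, ⟨l, hl⟩⟩ := hs
  rw [isOccurrence_append, isOccurrence_singleton] at hj hl
  have ht : w.length - 1 < w.length := by omega
  obtain ⟨k, k', s, hs, hu, e, e'⟩ := sync_of_occ hπ h hsq hw hj.1 hl.1 ht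
  obtain ⟨k₁, k₂, s', hs', hu', e₁, e₂⟩ := sync_of_occ hπ h hsq hw hj.1 hp ht
  obtain ⟨rfl, rfl⟩ := block_unique hπ.ne_nil (e.symm.trans e₁) hs hs'
  by_cases hlt : s + 1 < (π (u k)).length
  · refine absurd ?_ hbc
    rw [← hj.2, ← hl.2, show j + w.length = blockStart π u k + (s + 1) by omega,
      show l + w.length = blockStart π u k' + (s + 1) by omega, h.apply_block hlt,
      h.apply_block (by rw [← hu]; omega)]
    simp only [hu]
  · refine ⟨k₂ + 1, ?_⟩
    rw [blockStart_succ, ← hu']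
    omega

/-- Every occurrence of `w'` fills whole blocks, and injectivity of `π` on words makes its preimage
always the same `w`. Occurrences of `w'` and `w` thus correspond in order, and distinct extensions
come from distinct letters. -/
theorem exists_bispecial_preimage (hπ : IsMirrorCode π) (h : IsImage π u v)
    (hsq : ∀ m, u m = u (m + 1) → 2 < (π (u m)).length) {w' : List B}
    (hb : IsBispecial v w') (hw : 1 < w'.length) :
    ∃ w, IsBispecial u w ∧ w' = wordImage π w ∧
      ∀ r', IsReturnWord v w' r' → ∃ r, IsReturnWord u w r ∧ r' = wordImage π r := by
  have mono := blockStart_strictMono hπ.ne_nil u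
  have lift : ∀ {p}, IsOccurrence v w' p → ∃ m k, p = blockStart π u m ∧
      p + w'.length = blockStart π u (m + k) ∧ w' = wordImage π (window u m k) := by
    intro p hp
    obtain ⟨m, hm⟩ := exists_start_of_leftSpecial hπ h hsq hw hb.1 hp
    obtain ⟨k, hk⟩ := exists_end_of_rightSpecial hπ h hsq hw hb.2 hp
    have hmk : m ≤ k := mono.le_iff_le.1 (by omega)
    refine ⟨m, k - m, hm, by rw [hk, Nat.add_sub_cancel' hmk], ?_⟩
    rw [← h.window_eq hmk, ← hk, hm, Nat.add_sub_cancel_left, ← hm]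
    exact hp.symm
  obtain ⟨p₀, hp₀⟩ := hb.1.1
  obtain ⟨m₀, k₀, -, -, h₀⟩ := lift hp₀
  set w := window u m₀ k₀ with hwdef
  have lift' : ∀ {p}, IsOccurrence v w' p → ∃ m, p = blockStart π u m ∧
      p + w'.length = blockStart π u (m + w.length) ∧ IsOccurrence u w m := by
    intro p hp
    obtain ⟨m, k, h1, h2, h3⟩ := lift hp
    have h4 : w = window u m k := hπ.wordImage_injective (h₀.symm.trans h3)
    refine ⟨m, h1, ?_, ?_⟩
    · rw [h2, h4, length_window]
    · rw [h4]; exact isOccurrence_window _ _ _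
  have push : ∀ {m}, IsOccurrence u w m → IsOccurrence v w' (blockStart π u m) := by
    intro m hm
    rw [h₀]; exact h.occ_wordImage hm
  have hfac : IsFactor u w := ⟨m₀, isOccurrence_window _ _ _⟩
  refine ⟨w, ⟨⟨hfac, ?_⟩, ⟨hfac, ?_⟩⟩, h₀, ?_⟩
  · obtain ⟨-, b, c, hbc, ⟨j, hj⟩, ⟨l, hl⟩⟩ := hb.1
    have left : ∀ {j b}, IsOccurrence v (b :: w') j → ∃ i, IsFactor u (i :: w) ∧
        b = (π i).getLast (hπ.ne_nil i) := by
      intro j b hj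
      rw [isOccurrence_cons] at hj
      obtain ⟨m, h1, -, h2⟩ := lift' hj.2
      rcases m with _ | m
      · simp at h1
      · refine ⟨u m, ⟨m, isOccurrence_cons.2 ⟨rfl, h2⟩⟩, ?_⟩
        have hpos := List.length_pos_iff.2 (hπ.ne_nil (u m))
        rw [blockStart_succ] at h1
        rw [← hj.1, show j = blockStart π u m + ((π (u m)).length - 1) by omega,
          h.apply_block (by omega), List.getLast_eq_getElem]
    obtain ⟨i, hi, hi'⟩ := left hj
    obtain ⟨i', hi₁, hi₁'⟩ := left hl
    refine ⟨i, i', ?_, hi, hi₁⟩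
    rintro rfl
    exact hbc (hi'.trans hi₁'.symm)
  · obtain ⟨-, b, c, hbc, ⟨j, hj⟩, ⟨l, hl⟩⟩ := hb.2
    have right : ∀ {j b}, IsOccurrence v (w' ++ [b]) j → ∃ i, IsFactor u (w ++ [i]) ∧
        b = (π i).head (hπ.ne_nil i) := by
      intro j b hj
      rw [isOccurrence_append, isOccurrence_singleton] at hj
      obtain ⟨m, h1, h3, h2⟩ := lift' hj.1
      refine ⟨u (m + w.length), ⟨m, isOccurrence_append.2
        ⟨h2, isOccurrence_singleton.2 rfl⟩⟩, ?_⟩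
      have hpos := List.length_pos_iff.2 (hπ.ne_nil (u (m + w.length)))
      have := h.apply_block hpos
      rw [← hj.2, h3, List.head_eq_getElem]
      exact this
    obtain ⟨i, hi, hi'⟩ := right hj
    obtain ⟨i', hi₁, hi₁'⟩ := right hl
    refine ⟨i, i', ?_, hi, hi₁⟩
    rintro rfl
    exact hbc (hi'.trans hi₁'.symm)
  · rintro r' ⟨j, l, hjl, hj, hl, hno, rfl⟩
    obtain ⟨m, rfl, -, hm⟩ := lift' hj
    obtain ⟨m', rfl, -, hm'⟩ := lift' hl
    have hlt := mono.lt_iff_lt.1 hjl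
    refine ⟨window u m (m' - m), ⟨m, m', hlt, hm, hm', ?_, rfl⟩, h.window_eq hlt.le⟩
    intro k h1 h2 h3
    exact hno _ (mono h1) (mono h2) (push h3)

end sync

/-- The only square of a letter in the fixed point of `phi` is that of the last letter. -/
theorem eq_last_of_square {n : ℕ} [NeZero n] (hn : 2 ≤ n) {m : ℕ}
    (h : uSeq n m = uSeq n (m + 1)) : (uSeq n m).val = n - 1 := by
  have H := isMarkedImage_uSeq (n := n) hn
  obtain ⟨k, o, rfl, ho⟩ := exists_block (marked_ne_nil 0 (phiTail n)) (uSeq n) m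
  have hocc := isOccurrence_iff_getElem.1 (isOccurrence_append.1 (H.occ_tail k)).1
  have hne : next n (uSeq n k) ≠ 0 := fun h0 => H.not_mem (uSeq n k) (mem_phiTail.2 h0.symm)
  have hpos := List.length_pos_iff.2 (phiTail_ne_nil (uSeq n k))
  have key : ∀ t, t < (phiTail n (uSeq n k)).length →
      uSeq n (blockStart (marked 0 (phiTail n)) (uSeq n) k + 1 + t) = next n (uSeq n k) :=
    fun t ht => (hocc t ht).trans (mem_phiTail.1 (List.getElem_mem _))
  rcases o with _ | o
  · rw [Nat.add_zero, H.apply_start] at h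
    exact absurd ((key 0 hpos).symm.trans h.symm) hne
  · have ho' : o < (phiTail n (uSeq n k)).length := by simpa [marked] using ho
    rw [show ∀ s : ℕ, s + (o + 1) = s + 1 + o from fun s => by omega, key o ho'] at h ⊢
    by_cases hl : o + 1 < (phiTail n (uSeq n k)).length
    · have hk := (uSeq n k).isLt
      have : ¬ (uSeq n k).val + 1 < n := by
        intro hlt
        rw [phiTail, if_pos hlt] at hl
        simp at hl
      rw [val_next]; omega
    · have := IsMarkedImage.start_succ (a := 0) (q := phiTail n) (u := uSeq n) k
      rw [show blockStart (marked 0 (phiTail n)) (uSeq n) k + 1 + o + 1 =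
        blockStart (marked 0 (phiTail n)) (uSeq n) (k + 1) by omega, H.apply_start] at h
      exact absurd h hne

/-! ### Weighted morphisms -/

/-- If a letter also occurred outside a mirror pair, that pair could be overwritten by a letter `c`
taken from another image. The result is a palindrome of the same length that keeps all old letters
and gains `c`, against maximality. Another image exists as `1 ≤ d`. -/
theorem IsWeightedMorphism.mirrorDistinct {B : Type*} {d : ℕ} (hd : 1 ≤ d)
    {π : Fin (2 * d + 1) → List B} (hπ : IsWeightedMorphism d π) (i : Fin (2 * d + 1)) :
    MirrorDistinct (π i) := by
  intro s t hs ht hst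
  by_contra hcon
  push Not at hcon
  obtain ⟨j, hj⟩ : ∃ j : Fin (2 * d + 1), j ≠ i := by
    have : Nontrivial (Fin (2 * d + 1)) := Fin.nontrivial_iff_two_le.2 (by omega)
    exact exists_ne i
  obtain ⟨c, hc⟩ := List.exists_mem_of_ne_nil _ (hπ.ne_nil j)
  have hci : c ∉ π i := hπ.disjoint j i hj c hc
  set L := π i with hL
  set q := (L.set t c).set (L.length - 1 - t) c with hq
  have hlen : q.length = L.length := by simp [hq]
  have hget : ∀ k (hk : k < L.length), q[k]'(by omega) =
      if k = t ∨ k + t + 1 = L.length then c else L[k] := by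
    intro k hk
    simp only [hq, List.getElem_set]
    split_ifs <;> first | rfl | omega
  have hLrev : ∀ k (hk : k < L.length), L[L.length - 1 - k]'(by omega) = L[k] := by
    intro k hk
    have h1 : L.reverse[k]'(by simpa) = L[k] := by
      congr 1; exact (hπ.palindrome i).reverse_eq
    rw [← h1, List.getElem_reverse]
  have hpal : q.Palindrome := by
    rw [palindrome_iff]
    refine List.ext_getElem (by simp) fun k h1 h2 => ?_
    have hk : k < L.length := by omega
    rw [List.getElem_reverse]
    simp only [hlen]
    rw [hget _ (by omega), hget k hk, hLrev k hk]
    split_ifs <;> first | rfl | omega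
  have hmax := hπ.maximal i q hpal (hlen.trans (hπ.length_eq i))
  rw [← hL] at hmax
  have hsub : insert c {b | b ∈ L} ⊆ {b | b ∈ q} := by
    rintro b (rfl | hb)
    · have := hget t ht
      rw [if_pos (Or.inl rfl)] at this
      exact this ▸ List.getElem_mem _
    · obtain ⟨k, hk, rfl⟩ := List.getElem_of_mem hb
      by_cases hkt : k = t ∨ k + t + 1 = L.length
      · have h1 : L[k] = L[s] := by
          rcases hkt with rfl | hkt
          · exact hst.symm
          · rw [hst, ← hLrev t ht]; congr 1; omega
        have h2 := hget s hs
        rw [if_neg (by omega), ← h1] at h2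
        exact h2 ▸ List.getElem_mem _
      · have h2 := hget k hk
        rw [if_neg hkt] at h2
        exact h2 ▸ List.getElem_mem _
  have h1 := Set.ncard_le_ncard hsub (List.finite_toSet q)
  rw [Set.ncard_insert_of_notMem (by exact hci) (List.finite_toSet L)] at h1
  omega

theorem IsWeightedMorphism.isMirrorCode {B : Type*} {d : ℕ} (hd : 1 ≤ d)
    {π : Fin (2 * d + 1) → List B} (hπ : IsWeightedMorphism d π) : IsMirrorCode π where
  ne_nil := hπ.ne_nil
  pal := hπ.palindrome
  distinct := hπ.mirrorDistinct hd
  disjoint := hπ.disjoint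

end RichWords

theorem proposition8 {B : Type*} (d : ℕ) (hd : 1 ≤ d) (π : Fin (2 * d + 1) → List B)
    (hπ : IsWeightedMorphism d π) :
    (∀ p, IsFactor (uSeq (2 * d + 1)) p → (p.Palindrome ↔ (wordImage π p).Palindrome)) ∧
    IsRichSeq (seqImage π hπ.ne_nil (uSeq (2 * d + 1))) ∧
    (2 ≤ d → ∀ w', IsBispecial (seqImage π hπ.ne_nil (uSeq (2 * d + 1))) w' → 1 < w'.length →
      ∃ w, IsBispecial (uSeq (2 * d + 1)) w ∧ w' = wordImage π w ∧
        ∀ r', IsReturnWord (seqImage π hπ.ne_nil (uSeq (2 * d + 1))) w' r' →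
          ∃ r, IsReturnWord (uSeq (2 * d + 1)) w r ∧ r' = wordImage π r) := by
  have hcode := hπ.isMirrorCode hd
  have himg := isImage_seqImage π hπ.ne_nil (uSeq (2 * d + 1))
  refine ⟨fun p _ => hcode.palindrome_iff, ?_, ?_⟩
  · obtain ⟨a, ha⟩ : ∃ a, π 0 = [a] := by
      rw [← List.length_eq_one_iff, hπ.length_eq]
      simp [weight, show 0 < d by omega]
    exact isRichSeq_image_uSeq (by omega) hcode ha himg
  · intro hd2 w' hb hw
    refine exists_bispecial_preimage hcode himg (fun m hm => ?_) hb hw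
    -- The squared letter is `2d`, of weight `2 ^ d ≥ 4`; for `d = 1` the weight would be only 2.
    have hlast := eq_last_of_square (by omega) hm
    rw [hπ.length_eq, hlast, weight, if_neg (by omega),
      show 2 * d + 1 - 1 - d = d by omega]
    calc 2 < 2 ^ 2 := by norm_num
      _ ≤ 2 ^ d := Nat.pow_le_pow_right (by norm_num) hd2
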